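/- For a positive semidefinite complex matrix $A$ let $s(A)$ be its support projection, i.e. the orthogonal projection onto $(\ker A)^{\perp}$; let $A^{-1}$ be its generalized inverse (the inverse on the support, zero on the kernel), and put $A^{-r}:=(A^{-1})^{r}$ for $r>0$. For $0<\alpha<1$ and $p>0$ let $$A\#_\alpha B:=A^{1/2}(A^{-1/2}BA^{-1/2})^{\alpha}A^{1/2},\qquad \widetilde F_\alpha(A,B):=(A^{-1}\#_\alpha B)^{1/2}A^{2(1-\alpha)}(A^{-1}\#_\alpha B)^{1/2},$$ $$\widetilde{SG}_{\alpha,p}(A,B):=\widetilde F_\alpha(A^p,B^p)^{1/p},\qquad R_{\alpha,p}(A,B):=\bigl(A^{\frac{1-\alpha}{2}p}B^{\alpha p}A^{\frac{1-\alpha}{2}p}\bigr)^{1/p},$$ for $n\times n$ positive semidefinite matrices $A,B$ (any $n$) with $s(A)\ge s(B)$. For $n\times n$ positive semidefinite $X,Y$ with eigenvalues $\lambda_1\ge\dots\ge\lambda_n$ in decreasing order with multiplicities, $X\prec_{\log}Y$ means that $\prod_{i=1}^k\lambda_i(X)\le\prod_{i=1}^k\lambda_i(Y)$ for $1\le k\le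 n$, with equality for $k=n$. **Theorem 3.6.** Let $0<\alpha<1$ and $p,q>0$. (1) The following conditions are equivalent: (i) $\widetilde{SG}_{\alpha,p}(A,B)\prec_{\log}R_{\alpha,q}(A,B)$ for all positive semidefinite $A,B$ (of every size) with $s(A)\ge s(B)$; (ii) $\widetilde{SG}_{\alpha,p}(A,B)\prec_{\log}R_{\alpha,q}(A,B)$ for all $2\times2$ positive definite $A,B$; (iii) $p/q\le\alpha$. (2) If $\alpha\le1/2$ and $q\le p$, then $R_{\alpha,q}(A,B)\prec_{\log}\widetilde{SG}_{\alpha,p}(A,B)$ for all positive semidefinite $A,B$ with $s(A)\ge s(B)$. (3) If $R_{\alpha,q}(A,B)\prec_{\log}\widetilde{SG}_{\alpha,p}(A,B)$ for all $2\times2$ positive definite $A,B$, then $\alpha\le1/2$ and $p/q\ge1/2$. -/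

import Mathlib

open scoped MatrixOrder ComplexOrder

noncomputable section

namespace QuasiMean

/-- The support projection `s(A)` of `A`: the orthogonal projection onto the orthogonal complement
of the kernel of `A`, acting on `ℂⁿ` with its Euclidean inner product. Such projections are
compared in the Loewner order `≤` of operators on a Hilbert space. -/
def supportProj {n : ℕ} (A : Matrix (Fin n) (Fin n) ℂ) :
    EuclideanSpace ℂ (Fin n) →L[ℂ] EuclideanSpace ℂ (Fin n) :=
  ((LinearMap.ker (Matrix.toEuclideanLin A))ᗮ).starProjection

/-- The `α`-weighted geometric mean `A #_α B = A^{1/2} (A^{-1/2} B A^{-1/2})^α A^{1/2}`, for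
positive semidefinite `A`, `B` with `s(A) ≥ s(B)`.

Throughout, `A ^ r` for a real exponent `r` is the power by functional calculus. Since
`0 ^ r = 0` for every real `r ≠ 0`, for a singular positive semidefinite `A` and `r < 0` this is
the power of the generalized inverse (the inverse of `A` on its support, zero on its kernel). -/
def geomMean {n : ℕ} (α : ℝ) (A B : Matrix (Fin n) (Fin n) ℂ) : Matrix (Fin n) (Fin n) ℂ :=
  A ^ (1 / 2 : ℝ) * (A ^ (-(1 / 2) : ℝ) * B * A ^ (-(1 / 2) : ℝ)) ^ α * A ^ (1 / 2 : ℝ)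

/-- The weighted spectral geometric mean
`F̃_α(A, B) = (A⁻¹ #_α B)^{1/2} A^{2(1-α)} (A⁻¹ #_α B)^{1/2}`, where `A⁻¹` is the generalized
inverse. -/
def spectralMean {n : ℕ} (α : ℝ) (A B : Matrix (Fin n) (Fin n) ℂ) : Matrix (Fin n) (Fin n) ℂ :=
  (geomMean α (A ^ (-1 : ℝ)) B) ^ (1 / 2 : ℝ) * A ^ (2 * (1 - α)) *
    (geomMean α (A ^ (-1 : ℝ)) B) ^ (1 / 2 : ℝ)

/-- The quasi-extension `S̃G_{α,p}(A, B) = F̃_α(A^p, B^p)^{1/p}`. -/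
def quasiSpectralMean {n : ℕ} (α p : ℝ) (A B : Matrix (Fin n) (Fin n) ℂ) :
    Matrix (Fin n) (Fin n) ℂ :=
  (spectralMean α (A ^ p) (B ^ p)) ^ (1 / p)

/-- The Rényi mean `R_{α,p}(A, B) = (A^{(1-α)p/2} B^{αp} A^{(1-α)p/2})^{1/p}`. -/
def renyiMean {n : ℕ} (α p : ℝ) (A B : Matrix (Fin n) (Fin n) ℂ) : Matrix (Fin n) (Fin n) ℂ :=
  (A ^ ((1 - α) / 2 * p) * B ^ (α * p) * A ^ ((1 - α) / 2 * p)) ^ (1 / p)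

/-- Log-majorization `X ≺_log Y` of positive semidefinite matrices: with the eigenvalues
`λ₁ ≥ λ₂ ≥ … ≥ λₙ` in decreasing order with multiplicities (`eigenvalues₀`), the product of the
`k` largest eigenvalues of `X` is at most that of `Y` for each `1 ≤ k ≤ n`, and the products of
all the eigenvalues are equal. -/
def LogMajorizedBy {n : ℕ} (X Y : Matrix (Fin n) (Fin n) ℂ) : Prop :=
  ∃ (hX : X.PosSemidef) (hY : Y.PosSemidef),
    (∀ k, ∏ i ∈ Finset.Iic k, hX.isHermitian.eigenvalues₀ i ≤
      ∏ i ∈ Finset.Iic k, hY.isHermitian.eigenvalues₀ i) ∧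
    ∏ i, hX.isHermitian.eigenvalues₀ i = ∏ i, hY.isHermitian.eigenvalues₀ i

end QuasiMean

end

/-
Compound matrices (antisymmetric tensor powers) commute with products and powers, and the norm of
the `k`-th compound of a positive semidefinite matrix is the product of its `k` largest
eigenvalues. So each log-majorization reduces to an inequality of operator norms together with
equality of determinants. By homogeneity a norm inequality is an implication between Loewner
inequalities for powers of the arguments, which comes from the Löwner–Heinz inequality for
`S̃G ≺ R` and from a form of the Furuta inequality for `R ≺ S̃G`. A singular `A` is first replaced
by `A + P`, with `P` the orthogonal projection onto its kernel: this is invertible and, because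
`s(B) ≤ s(A)`, gives the same means.

For necessity, both norms are computed for `A = diag(1, t)` and `B` a rank-one projection, a limit
of positive definite matrices; comparing the orders of vanishing as `t → 0` gives the constraints
on the parameters.
-/

noncomputable section

namespace QuasiMean

open Filter Topology

section CStarAlgebra

lemma norm_of_isStarProjection {𝒜 : Type*} [NonUnitalNormedRing 𝒜] [StarRing 𝒜] [CStarRing 𝒜]
    {e : 𝒜} (he : IsStarProjection e) (he₀ : e ≠ 0) : ‖e‖ = 1 := by
  have h_sq : ‖e‖ * ‖e‖ = ‖e‖ := by
    rw [← CStarRing.norm_star_mul_self, he.isSelfAdjoint, he.isIdempotentElem]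
  exact (mul_eq_left₀ (norm_ne_zero_iff.mpr he₀)).mp h_sq

variable {𝒜 : Type*} [CStarAlgebra 𝒜] [PartialOrder 𝒜] [StarOrderedRing 𝒜] {a b : 𝒜}

lemma rpow_rpow_of_isStrictlyPositive (ha : IsStrictlyPositive a) (x y : ℝ) :
    (a ^ x) ^ y = a ^ (x * y) := by
  rcases eq_or_ne x 0 with rfl | hx
  · rw [zero_mul, CFC.rpow_zero a ha.nonneg, CFC.one_rpow]
  · exact CFC.rpow_rpow a x y hx

lemma smul_rpow (ha : 0 ≤ a) {c r : ℝ} (hc : 0 ≤ c) (hr : 0 ≤ r) :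
    (c • a) ^ r = c ^ r • a ^ r := by
  have h_cont : Continuous fun x : ℝ => x ^ r := Real.continuous_rpow_const hr
  rw [CFC.rpow_eq_cfc_real (smul_nonneg hc ha), CFC.rpow_eq_cfc_real ha,
    ← cfc_comp_smul c _ a h_cont.continuousOn, ← cfc_smul _ _ a h_cont.continuousOn]
  exact cfc_congr fun x hx => Real.mul_rpow hc (spectrum_nonneg_of_nonneg ha hx)

lemma rpow_conj_rpow_conj (ha : IsStrictlyPositive a) (x y : ℝ) (b : 𝒜) :
    a ^ x * (a ^ y * b * a ^ y) * a ^ x = a ^ (x + y) * b * a ^ (x + y) := by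
  simp only [mul_assoc, ← CFC.rpow_add ha.isUnit, add_comm y x]
  simp only [← mul_assoc, ← CFC.rpow_add ha.isUnit]

lemma rpow_conj_rpow (ha : IsStrictlyPositive a) (x y : ℝ) :
    a ^ x * a ^ y * a ^ x = a ^ (y + 2 * x) := by
  rw [← CFC.rpow_add ha.isUnit, ← CFC.rpow_add ha.isUnit]
  congr 1
  ring

lemma rpow_conj_le_smul_rpow_iff (ha : IsStrictlyPositive a) (c x y : ℝ) :
    a ^ x * b * a ^ x ≤ c • a ^ y ↔ b ≤ c • a ^ (y - 2 * x) := by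
  have conj_mono (z : ℝ) {d e : 𝒜} (h : d ≤ e) : a ^ z * d * a ^ z ≤ a ^ z * e * a ^ z :=
    conjugate_le_conjugate_of_nonneg h CFC.rpow_nonneg
  have conj_smul (z w : ℝ) : a ^ z * (c • a ^ w) * a ^ z = c • a ^ (w + 2 * z) := by
    rw [mul_smul_comm, smul_mul_assoc, rpow_conj_rpow ha]
  constructor <;> intro h
  · have := conj_mono (-x) h
    rw [rpow_conj_rpow_conj ha, conj_smul, neg_add_cancel, CFC.rpow_zero a ha.nonneg,
      one_mul, mul_one] at this
    rwa [sub_eq_add_neg, ← mul_neg]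
  · have := conj_mono x h
    rwa [conj_smul, sub_add_cancel] at this

lemma rpow_le_smul_rpow (ha : IsStrictlyPositive a) {c y s : ℝ} (hc : 0 ≤ c)
    (hs : s ∈ Set.Icc (0 : ℝ) 1) (h : b ≤ c • a ^ y) : b ^ s ≤ c ^ s • a ^ (y * s) := by
  rw [← rpow_rpow_of_isStrictlyPositive ha, ← smul_rpow CFC.rpow_nonneg hc hs.1]
  exact CFC.rpow_le_rpow hs h

-- The unit is written as `a ^ 0` so that `rpow_conj_le_smul_rpow_iff` applies to the bound.
lemma norm_le_iff_le_smul_rpow_zero (ha : 0 ≤ a) (hb : 0 ≤ b) {c : ℝ} (hc : 0 ≤ c) :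
    ‖b‖ ≤ c ↔ b ≤ c • a ^ (0 : ℝ) := by
  rw [CStarAlgebra.norm_le_iff_le_algebraMap b hc hb, Algebra.algebraMap_eq_smul_one,
    CFC.rpow_zero a ha]

lemma rpow_neg_le_rpow_neg (ha : IsStrictlyPositive a) (h : a ≤ b) {s : ℝ}
    (hs : s ∈ Set.Icc (0 : ℝ) 1) : b ^ (-s) ≤ a ^ (-s) := by
  have hb : IsStrictlyPositive b := ha.of_le h
  have h_inv {d : 𝒜} (hd : IsStrictlyPositive d) : d ^ (-s) = Ring.inverse (d ^ s) := by
    rw [CFC.inverse_eq_rpow_neg_one (hd.rpow d s), rpow_rpow_of_isStrictlyPositive hd, mul_neg_one]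
  rw [h_inv ha, h_inv hb]
  exact CStarAlgebra.ringInverse_le_ringInverse (CFC.rpow_le_rpow hs h) (ha.rpow a s)

lemma map_rpow {ℬ : Type*} [CStarAlgebra ℬ] [PartialOrder ℬ] [StarOrderedRing ℬ]
    (φ : 𝒜 →⋆ₐ[ℂ] ℬ) (ha : 0 ≤ a) {r : ℝ} (hr : ContinuousOn (fun x : ℝ => x ^ r) (spectrum ℝ a)) :
    φ (a ^ r) = φ a ^ r := by
  have hφa : 0 ≤ φ a := map_nonneg φ ha
  rw [CFC.rpow_eq_cfc_real ha, CFC.rpow_eq_cfc_real hφa]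
  exact φ.map_cfc _ a hr (map_continuous φ) ha.isSelfAdjoint hφa.isSelfAdjoint

lemma mul_star_rpow {m : 𝒜} (hm : IsUnit m) (s : ℝ) :
    (m * star m) ^ s = m * (star m * m) ^ (s - 1) * star m := by
  set h := star m * m with h_def
  have hh : IsStrictlyPositive h := ⟨star_mul_self_nonneg m, hm.star.mul hm⟩
  have h_one : h ^ (1 : ℝ) = h := CFC.rpow_one h hh.nonneg
  have h_zero : h ^ (0 : ℝ) = 1 := CFC.rpow_zero h hh.nonneg
  have star_pow (r : ℝ) : star (h ^ r) = h ^ r := (CFC.rpow_nonneg (a := h)).isSelfAdjoint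
  -- The unitary factor of the polar decomposition `m = u |m|`.
  set u := m * h ^ (-(1 / 2) : ℝ) with u_def
  have hu : u ∈ unitary 𝒜 := by
    have hu_unit : IsUnit u := hm.mul (hh.rpow h _).isUnit
    have h_star_mul : star u * u = 1 := calc
      star u * u = h ^ (-(1 / 2) : ℝ) * h ^ (1 : ℝ) * h ^ (-(1 / 2) : ℝ) := by
        rw [u_def, star_mul, star_pow, h_one, h_def]
        simp only [mul_assoc]
      _ = 1 := by
        rw [rpow_conj_rpow hh]
        norm_num [h_zero]
    exact hu_unit.mem_unitary_iff_star_mul_self.mpr h_star_mul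
  have conj_u (r : ℝ) :
      (Unitary.conjStarAlgAut ℂ 𝒜 ⟨u, hu⟩ : 𝒜 →⋆ₐ[ℂ] 𝒜) (h ^ r) = m * h ^ (r - 1) * star m := calc
    u * h ^ r * star u = m * (h ^ (-(1 / 2) : ℝ) * h ^ r * h ^ (-(1 / 2) : ℝ)) * star m := by
      rw [u_def, star_mul, star_pow]
      simp only [mul_assoc]
    _ = m * h ^ (r - 1) * star m := by
      rw [rpow_conj_rpow hh]
      norm_num [sub_eq_add_neg]
  have h_spec : ContinuousOn (fun x : ℝ => x ^ s) (spectrum ℝ h) := fun x hx =>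
    (Real.continuousAt_rpow_const x s
      (.inl (ne_of_mem_of_not_mem hx (spectrum.zero_notMem ℝ hh.isUnit)))).continuousWithinAt
  have conj_u_one := conj_u 1
  rw [h_one, sub_self, h_zero, mul_one] at conj_u_one
  rw [← conj_u s, map_rpow _ hh.nonneg h_spec, conj_u_one]

lemma isStrictlyPositive_rpow_conj (ha : IsStrictlyPositive a) (hb : IsStrictlyPositive b)
    (x : ℝ) : IsStrictlyPositive (a ^ x * b * a ^ x) := by
  have := (ha.rpow a x).isUnit.isStrictlyPositive_star_left_conjugate_iff.mpr hb
  rwa [CFC.rpow_nonneg.isSelfAdjoint] at this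

lemma continuousOn_rpow_of_nonneg {r : ℝ} (hr : 0 < r) :
    ContinuousOn (fun a : 𝒜 => a ^ r) {a | 0 ≤ a} := by
  lift r to NNReal using hr.le
  simpa only [CFC.nnrpow_eq_rpow (NNReal.coe_pos.mp hr)] using CFC.continuousOn_nnrpow (A := 𝒜) r

lemma furuta_of_le_one (hb : IsStrictlyPositive b) (h : b ≤ a) {α r : ℝ} (hα₀ : 0 < α)
    (hα₁ : α ≤ 1) (hr₀ : 0 ≤ r) (hr₁ : r ≤ 1) :
    (a ^ (r / 2) * b ^ (1 / α) * a ^ (r / 2)) ^ α ≤ a ^ (1 + r * α) := by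
  have ha : IsStrictlyPositive a := hb.of_le h
  set m := a ^ (r / 2) * b ^ (1 / α / 2) with m_def
  have star_m : star m = b ^ (1 / α / 2) * a ^ (r / 2) := by
    rw [m_def, star_mul, CFC.rpow_nonneg.isSelfAdjoint, CFC.rpow_nonneg.isSelfAdjoint]
  have star_m_mul_m : b ^ (1 / α + r) ≤ star m * m := calc
    b ^ (1 / α + r) = b ^ (1 / α / 2) * b ^ r * b ^ (1 / α / 2) := by
      rw [rpow_conj_rpow hb]
      ring_nf
    _ ≤ b ^ (1 / α / 2) * a ^ r * b ^ (1 / α / 2) :=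
      conjugate_le_conjugate_of_nonneg (CFC.rpow_le_rpow ⟨hr₀, hr₁⟩ h) CFC.rpow_nonneg
    _ = star m * m := by
      rw [star_m, m_def, ← add_halves r, CFC.rpow_add ha.isUnit, add_halves]
      simp only [mul_assoc]
  calc (a ^ (r / 2) * b ^ (1 / α) * a ^ (r / 2)) ^ α = (m * star m) ^ α := by
        rw [star_m, m_def, ← add_halves (1 / α), CFC.rpow_add hb.isUnit, add_halves]
        simp only [mul_assoc]
    _ = m * (star m * m) ^ (-(1 - α)) * star m := by
        rw [mul_star_rpow ((ha.rpow a _).isUnit.mul (hb.rpow b _).isUnit), neg_sub]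
    _ ≤ m * (b ^ (1 / α + r)) ^ (-(1 - α)) * star m :=
        star_right_conjugate_le_conjugate (rpow_neg_le_rpow_neg (hb.rpow b _) star_m_mul_m
          ⟨by linarith, by linarith⟩) m
    _ = a ^ (r / 2) * (b ^ (1 / α / 2) * b ^ ((1 / α + r) * (α - 1)) * b ^ (1 / α / 2)) *
          a ^ (r / 2) := by
        rw [star_m, m_def, rpow_rpow_of_isStrictlyPositive hb, neg_sub]
        simp only [mul_assoc]
    _ = a ^ (r / 2) * b ^ (1 - r + r * α) * a ^ (r / 2) := by
        rw [rpow_conj_rpow hb]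
        congr 3
        field_simp
        ring
    _ ≤ a ^ (r / 2) * a ^ (1 - r + r * α) * a ^ (r / 2) :=
        conjugate_le_conjugate_of_nonneg
          (CFC.rpow_le_rpow ⟨by nlinarith, by nlinarith⟩ h) CFC.rpow_nonneg
    _ = a ^ (1 + r * α) := by
        rw [rpow_conj_rpow ha]
        ring_nf

lemma furuta_of_isStrictlyPositive (hb : IsStrictlyPositive b) (h : b ≤ a) {α r : ℝ} (hα₀ : 0 < α)
    (hα₁ : α ≤ 1) (hr : 0 ≤ r) :
    (a ^ (r / 2) * b ^ (1 / α) * a ^ (r / 2)) ^ α ≤ a ^ (1 + r * α) := by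
  have ha : IsStrictlyPositive a := hb.of_le h
  obtain ⟨n, hn⟩ := exists_nat_ge r
  induction n generalizing r with
  | zero => exact furuta_of_le_one hb h hα₀ hα₁ hr (hn.trans (by norm_num))
  | succ n ih =>
    rcases le_total r 1 with hr₁ | hr₁
    · exact furuta_of_le_one hb h hα₀ hα₁ hr hr₁
    -- The inequality at `r - 1` reads `e ^ α ≤ a ^ (1 + (r - 1) * α)`; the base case for this pair,
    -- with its exponent chosen to multiply both ends by `a ^ (1 / 2)`, is the inequality at `r`.
    set e := a ^ ((r - 1) / 2) * b ^ (1 / α) * a ^ ((r - 1) / 2) with e_def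
    have he : IsStrictlyPositive e := isStrictlyPositive_rpow_conj ha (hb.rpow b _) _
    have he_le : e ^ α ≤ a ^ (1 + (r - 1) * α) :=
      ih (sub_nonneg.mpr hr₁) (by push_cast at hn; linarith)
    have h_pos : 1 ≤ 1 + (r - 1) * α := le_add_of_nonneg_right (by bound)
    have key := furuta_of_le_one (he.rpow e α) he_le (r := 1 / (1 + (r - 1) * α)) hα₀ hα₁
      (by positivity) ((div_le_one (by positivity)).mpr h_pos)
    simp only [rpow_rpow_of_isStrictlyPositive ha, rpow_rpow_of_isStrictlyPositive he] at key
    rw [mul_one_div_cancel hα₀.ne', CFC.rpow_one e he.nonneg] at key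
    convert key using 2
    · rw [e_def, rpow_conj_rpow_conj ha]
      congr 3 <;> field_simp <;> ring
    · field_simp
      ring

lemma furuta (ha : IsStrictlyPositive a) (hb : 0 ≤ b) (h : b ≤ a) {α r : ℝ} (hα₀ : 0 < α)
    (hα₁ : α ≤ 1) (hr : 0 ≤ r) :
    (a ^ (r / 2) * b ^ (1 / α) * a ^ (r / 2)) ^ α ≤ a ^ (1 + r * α) := by
  let bε : ℝ → 𝒜 := fun ε => (1 - ε) • b + ε • a
  have bε_mem {ε : ℝ} (hε : ε ∈ Set.Ioo 0 1) : IsStrictlyPositive (bε ε) ∧ bε ε ≤ a := by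
    refine ⟨.nonneg_add (smul_nonneg (by linarith [hε.2]) hb) (ha.smul hε.1), ?_⟩
    calc bε ε ≤ (1 - ε) • a + ε • a :=
          add_le_add_left (smul_le_smul_of_nonneg_left h (by linarith [hε.2])) _
      _ = a := by rw [← add_smul, sub_add_cancel, one_smul]
  have h_ioo : Set.Ioo (0 : ℝ) 1 ∈ 𝓝[>] 0 := Ioo_mem_nhdsGT one_pos
  have h_tendsto : Tendsto bε (𝓝[>] 0) (𝓝[{x | 0 ≤ x}] b) := by
    refine tendsto_nhdsWithin_iff.mpr ⟨?_, ?_⟩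
    · refine (Continuous.tendsto' (by fun_prop) 0 b ?_).mono_left nhdsWithin_le_nhds
      simp [bε]
    · filter_upwards [h_ioo] with ε hε using (bε_mem hε).1.nonneg
  have h_cont : ContinuousOn (fun x : 𝒜 => (a ^ (r / 2) * x ^ (1 / α) * a ^ (r / 2)) ^ α)
      {x | 0 ≤ x} :=
    (continuousOn_rpow_of_nonneg hα₀).comp (((continuousOn_rpow_of_nonneg
      (by positivity)).const_mul _).mul_const _) fun x _ =>
        conjugate_nonneg_of_nonneg CFC.rpow_nonneg CFC.rpow_nonneg
  refine le_of_tendsto ((h_cont b hb).tendsto.comp h_tendsto) ?_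
  filter_upwards [h_ioo] with ε hε
  exact furuta_of_isStrictlyPositive (bε_mem hε).1 (bε_mem hε).2 hα₀ hα₁ hr

lemma rpow_half_conj_rpow_le {c d : 𝒜} (hc : 0 ≤ c) (hd : IsStrictlyPositive d) {α : ℝ}
    (hα₀ : 0 < α) (hα₁ : α ≤ 1 / 2) (h : c ^ α ≤ d ^ (1 - 2 * α)) :
    (d ^ (1 / 2 : ℝ) * c * d ^ (1 / 2 : ℝ)) ^ α ≤ d ^ (1 - α) := by
  rcases hα₁.lt_or_eq with hα₁ | rfl
  · have hα₂ : 0 < 1 - 2 * α := by linarith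
    have key := furuta (hd.rpow d _) CFC.rpow_nonneg h hα₀ (by linarith)
      (r := 1 / (1 - 2 * α)) (by positivity)
    rw [CFC.rpow_rpow_of_exponent_nonneg c _ _ hα₀.le (by positivity), mul_one_div_cancel hα₀.ne',
      CFC.rpow_one c] at key
    simp only [rpow_rpow_of_isStrictlyPositive hd] at key
    convert key using 3
    · congr 1
      field_simp
    · field_simp
    · rw [mul_add, mul_one, ← mul_assoc, mul_one_div_cancel hα₂.ne']
      ring
  · have hc_le : c ≤ 1 := by
      have h_root : ‖c ^ (1 / 2 : ℝ)‖ ≤ 1 := by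
        rw [CStarAlgebra.norm_le_one_iff_of_nonneg _ CFC.rpow_nonneg]
        simpa [CFC.rpow_zero d hd.nonneg] using h
      rw [CFC.norm_rpow c one_half_pos, ← Real.sqrt_eq_rpow, Real.sqrt_le_one] at h_root
      exact (CStarAlgebra.norm_le_one_iff_of_nonneg c hc).mp h_root
    calc (d ^ (1 / 2 : ℝ) * c * d ^ (1 / 2 : ℝ)) ^ (1 / 2 : ℝ)
      _ ≤ (d ^ (1 / 2 : ℝ) * 1 * d ^ (1 / 2 : ℝ)) ^ (1 / 2 : ℝ) :=
        CFC.rpow_le_rpow (by norm_num)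
          (conjugate_le_conjugate_of_nonneg hc_le CFC.rpow_nonneg)
      _ = d ^ (1 - 1 / 2 : ℝ) := by
        rw [mul_one, ← CFC.rpow_add hd.isUnit, rpow_rpow_of_isStrictlyPositive hd]
        norm_num

lemma rpow_half_conj_rpow_le_smul {c d : 𝒜} (hc : 0 ≤ c) (hd : IsStrictlyPositive d) {α t : ℝ}
    (hα₀ : 0 < α) (hα₁ : α ≤ 1 / 2) (ht : 0 < t) (h : c ^ α ≤ t • d ^ (1 - 2 * α)) :
    (d ^ (1 / 2 : ℝ) * c * d ^ (1 / 2 : ℝ)) ^ α ≤ t • d ^ (1 - α) := by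
  have ht_pow : (t⁻¹ ^ α⁻¹) ^ α = t⁻¹ := Real.rpow_inv_rpow (by positivity) hα₀.ne'
  -- Homogeneity: rescale `c` so that the constant becomes `1`.
  have key := rpow_half_conj_rpow_le (c := t⁻¹ ^ α⁻¹ • c) (smul_nonneg (by positivity) hc) hd
    hα₀ hα₁ (by
      rwa [smul_rpow hc (by positivity) hα₀.le, ht_pow, inv_smul_le_iff_of_pos ht])
  rwa [mul_smul_comm, smul_mul_assoc, smul_rpow (conjugate_nonneg_of_nonneg hc CFC.rpow_nonneg)
    (by positivity) hα₀.le, ht_pow, inv_smul_le_iff_of_pos ht] at key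

/-- The element `a^{(1-α)q/2} b^{αq} a^{(1-α)q/2}`, whose power of exponent `1/q` is the Rényi
mean `R_{α,q}(a, b)`. -/
def renyiCore (α q : ℝ) (a b : 𝒜) : 𝒜 :=
  a ^ ((1 - α) / 2 * q) * b ^ (α * q) * a ^ ((1 - α) / 2 * q)

/-- The element `a^{(1/2-α)p} (a^{p/2} b^p a^{p/2})^α a^{(1/2-α)p}`. With `G = a⁻ᵖ #_α bᵖ` it equals
`a^{(1-α)p} G a^{(1-α)p}`, so for invertible `a` it has the same norm as
`F̃_α(aᵖ, bᵖ) = G^{1/2} a^{2(1-α)p} G^{1/2}`. -/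
def spectralCore (α p : ℝ) (a b : 𝒜) : 𝒜 :=
  a ^ ((1 / 2 - α) * p) * (a ^ (p / 2) * b ^ p * a ^ (p / 2)) ^ α * a ^ ((1 / 2 - α) * p)

lemma renyiCore_nonneg (α q : ℝ) (a b : 𝒜) : 0 ≤ renyiCore α q a b :=
  conjugate_nonneg_of_nonneg CFC.rpow_nonneg CFC.rpow_nonneg

lemma spectralCore_nonneg (α p : ℝ) (a b : 𝒜) : 0 ≤ spectralCore α p a b :=
  conjugate_nonneg_of_nonneg CFC.rpow_nonneg CFC.rpow_nonneg

lemma norm_spectralCore_le (ha : IsStrictlyPositive a) (hb : 0 ≤ b) {α p q : ℝ}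
    (hα₀ : 0 < α) (hα₁ : α ≤ 1) (hp : 0 < p) (hq : 0 < q) (hpq : p ≤ α * q) :
    ‖spectralCore α p a b‖ ≤ ‖renyiCore α q a b‖ ^ (p / q) := by
  set N := ‖renyiCore α q a b‖
  have hN : 0 ≤ N := norm_nonneg _
  have h_renyi : b ^ (α * q) ≤ N • a ^ (-(1 - α) * q) := by
    have := (norm_le_iff_le_smul_rpow_zero ha.nonneg (renyiCore_nonneg α q a b) hN).mp le_rfl
    rw [renyiCore, rpow_conj_le_smul_rpow_iff ha] at this
    convert this using 3
    ring
  have h_pow : b ^ p ≤ N ^ (p / (α * q)) • a ^ (-(1 - α) * (p / α)) := by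
    have := rpow_le_smul_rpow ha hN (s := p / (α * q))
      ⟨by positivity, (div_le_one (by positivity)).mpr hpq⟩ h_renyi
    rw [CFC.rpow_rpow_of_exponent_nonneg b _ _ (by positivity) (by positivity),
      mul_div_cancel₀ p (by positivity)] at this
    convert this using 3
    field_simp
  have h_conj : a ^ (p / 2) * b ^ p * a ^ (p / 2) ≤
      N ^ (p / (α * q)) • a ^ (-(1 - α) * (p / α) + p) := by
    rw [rpow_conj_le_smul_rpow_iff ha]
    convert h_pow using 3
    ring
  rw [norm_le_iff_le_smul_rpow_zero ha.nonneg (spectralCore_nonneg α p a b) (by positivity),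
    spectralCore, rpow_conj_le_smul_rpow_iff ha]
  have := rpow_le_smul_rpow ha (Real.rpow_nonneg hN _) ⟨hα₀.le, hα₁⟩ h_conj
  rw [← Real.rpow_mul hN] at this
  convert this using 3
  · field_simp
  · field_simp
    ring

lemma rpow_le_smul_rpow_of_norm_spectralCore_lt (ha : IsStrictlyPositive a) (hb : 0 ≤ b)
    {α p t : ℝ} (hα₀ : 0 < α) (hα₁ : α ≤ 1 / 2) (hp : 0 < p) (h : ‖spectralCore α p a b‖ < t) :
    b ^ (α * p) ≤ t • a ^ (-(1 - α) * p) := by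
  have ht : 0 < t := (norm_nonneg _).trans_lt h
  have h_spectral : (a ^ (p / 2) * b ^ p * a ^ (p / 2)) ^ α ≤ t • (a ^ (-p)) ^ (1 - 2 * α) := by
    have := (norm_le_iff_le_smul_rpow_zero ha.nonneg (spectralCore_nonneg α p a b) ht.le).mp h.le
    rw [spectralCore, rpow_conj_le_smul_rpow_iff ha] at this
    rw [rpow_rpow_of_isStrictlyPositive ha]
    convert this using 3
    ring
  have := rpow_half_conj_rpow_le_smul (conjugate_nonneg_of_nonneg CFC.rpow_nonneg
    CFC.rpow_nonneg) (ha.rpow a (-p)) hα₀ hα₁ ht h_spectral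
  rw [rpow_rpow_of_isStrictlyPositive ha, rpow_rpow_of_isStrictlyPositive ha,
    rpow_conj_rpow_conj ha, show -p * (1 / 2) + p / 2 = 0 by ring, CFC.rpow_zero a ha.nonneg,
    one_mul, mul_one, CFC.rpow_rpow_of_exponent_nonneg b _ _ hp.le hα₀.le] at this
  convert this using 2
  · ring
  · ring_nf

lemma norm_renyiCore_le (ha : IsStrictlyPositive a) (hb : 0 ≤ b) {α p q : ℝ}
    (hα₀ : 0 < α) (hα₁ : α ≤ 1 / 2) (hq : 0 < q) (hqp : q ≤ p) :
    ‖renyiCore α q a b‖ ≤ ‖spectralCore α p a b‖ ^ (q / p) := by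
  have hp : 0 < p := hq.trans_le hqp
  have le_of_lt (t : ℝ) (h_lt : ‖spectralCore α p a b‖ < t) :
      ‖renyiCore α q a b‖ ≤ t ^ (q / p) := by
    have ht : 0 < t := (norm_nonneg _).trans_lt h_lt
    have h_pow := rpow_le_smul_rpow ha ht.le (s := q / p) ⟨by positivity, (div_le_one hp).mpr hqp⟩
      (rpow_le_smul_rpow_of_norm_spectralCore_lt ha hb hα₀ hα₁ hp h_lt)
    rw [CFC.rpow_rpow_of_exponent_nonneg b _ _ (by positivity) (by positivity), mul_assoc,
      mul_assoc, mul_div_cancel₀ q hp.ne'] at h_pow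
    rw [norm_le_iff_le_smul_rpow_zero ha.nonneg (renyiCore_nonneg α q a b) (by positivity),
      renyiCore, rpow_conj_le_smul_rpow_iff ha]
    convert h_pow using 3
    ring
  have h_tendsto : Tendsto (fun t : ℝ => t ^ (q / p)) (𝓝[>] ‖spectralCore α p a b‖)
      (𝓝 (‖spectralCore α p a b‖ ^ (q / p))) :=
    (Real.continuous_rpow_const (by positivity)).tendsto _ |>.mono_left nhdsWithin_le_nhds
  refine ge_of_tendsto h_tendsto ?_
  filter_upwards [self_mem_nhdsWithin] using le_of_lt

lemma closure_isStrictlyPositive : closure {a : 𝒜 | IsStrictlyPositive a} = {a | 0 ≤ a} := by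
  refine (closure_minimal (fun a ha => ha.nonneg) (isClosed_Ici (a := (0 : 𝒜)))).antisymm
    fun a ha => ?_
  have h_tendsto : Tendsto (fun ε : ℝ => a + ε • (1 : 𝒜)) (𝓝[>] 0) (𝓝 a) :=
    (Continuous.tendsto' (by fun_prop) 0 a (by simp)).mono_left nhdsWithin_le_nhds
  refine mem_closure_of_tendsto h_tendsto ?_
  filter_upwards [self_mem_nhdsWithin] with ε hε
  exact .nonneg_add ha (isStrictlyPositive_one.smul hε)

lemma continuousOn_renyiCore (a : 𝒜) {α q : ℝ} (hα : 0 < α) (hq : 0 < q) :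
    ContinuousOn (renyiCore α q a) {b | 0 ≤ b} :=
  ((continuousOn_rpow_of_nonneg (by positivity)).const_mul _).mul_const _

lemma continuousOn_spectralCore (a : 𝒜) {α p : ℝ} (hα : 0 < α) (hp : 0 < p) :
    ContinuousOn (spectralCore α p a) {b | 0 ≤ b} :=
  (((continuousOn_rpow_of_nonneg hα).comp
    (((continuousOn_rpow_of_nonneg hp).const_mul _).mul_const _) fun _ _ =>
      conjugate_nonneg_of_nonneg CFC.rpow_nonneg CFC.rpow_nonneg).const_mul _).mul_const _

section Compression

variable {e : 𝒜}

lemma rpow_of_isStarProjection (he : IsStarProjection e) {r : ℝ} (hr : 0 < r) : e ^ r = e := by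
  have h_spec : Set.EqOn (fun x : ℝ => x ^ r) (fun x => x) (spectrum ℝ e) := fun x hx => by
    rcases he.isIdempotentElem.spectrum_subset ℝ hx with rfl | rfl
    · exact Real.zero_rpow hr.ne'
    · exact Real.one_rpow r
  rw [CFC.rpow_eq_cfc_real he.nonneg, cfc_congr h_spec, cfc_id' ℝ e he.isSelfAdjoint]

lemma norm_rpow_conj (he : IsStarProjection e) (x : ℝ) :
    ‖a ^ x * e * a ^ x‖ = ‖e * (a ^ x * a ^ x) * e‖ := by
  have h_star : star (a ^ x * e) = e * a ^ x := by
    rw [star_mul, he.isSelfAdjoint, CFC.rpow_nonneg.isSelfAdjoint]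
  calc ‖a ^ x * e * a ^ x‖ = ‖(a ^ x * e) * star (a ^ x * e)‖ := by
        rw [h_star, mul_assoc, mul_assoc, ← mul_assoc e e, he.isIdempotentElem]
    _ = ‖star (a ^ x * e) * (a ^ x * e)‖ := by
        rw [CStarRing.norm_self_mul_star, CStarRing.norm_star_mul_self]
    _ = ‖e * (a ^ x * a ^ x) * e‖ := by rw [h_star]; simp only [mul_assoc]

lemma norm_renyiCore_of_isStarProjection (ha : IsStrictlyPositive a) (he : IsStarProjection e)
    (he₀ : e ≠ 0) {α q : ℝ} {m : ℝ → ℝ} (hm : ∀ r, 0 ≤ m r)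
    (h : ∀ r, e * a ^ r * e = m r • e) (hα : 0 < α) (hq : 0 < q) :
    ‖renyiCore α q a e‖ = m ((1 - α) * q) := by
  rw [renyiCore, rpow_of_isStarProjection he (by positivity), norm_rpow_conj he,
    ← CFC.rpow_add ha.isUnit, h, norm_smul,
    norm_of_isStarProjection he he₀, mul_one, Real.norm_of_nonneg (hm _)]
  congr 1
  ring

lemma norm_spectralCore_of_isStarProjection (ha : IsStrictlyPositive a) (he : IsStarProjection e)
    (he₀ : e ≠ 0) {α p : ℝ} {m : ℝ → ℝ} (hm : ∀ r, 0 < m r)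
    (h : ∀ r, e * a ^ r * e = m r • e) (hα : 0 < α) (hp : 0 < p) :
    ‖spectralCore α p a e‖ = m p ^ (α - 1) * m (2 * (1 - α) * p) := by
  set w := a ^ (p / 2) * e * a ^ (p / 2) with w_def
  have h_proj : IsStarProjection ((m p)⁻¹ • w) := by
    have w_mul_w : w * w = m p • w := calc
      w * w = a ^ (p / 2) * (e * (a ^ (p / 2) * a ^ (p / 2)) * e) * a ^ (p / 2) := by
        simp only [w_def, mul_assoc]
      _ = m p • w := by
        rw [← CFC.rpow_add ha.isUnit, add_halves, h, mul_smul_comm, smul_mul_assoc]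
    have hw : IsSelfAdjoint w := by
      simpa only [w_def, (CFC.rpow_nonneg (a := a)).isSelfAdjoint.star_eq] using
        he.isSelfAdjoint.conjugate (a ^ (p / 2))
    refine ⟨?_, .smul (.all _) hw⟩
    rw [IsIdempotentElem, smul_mul_smul_comm, w_mul_w, smul_smul, mul_assoc,
      inv_mul_cancel₀ (hm p).ne', mul_one]
  have w_rpow : w ^ α = m p ^ (α - 1) • w := calc
    w ^ α = (m p • (m p)⁻¹ • w) ^ α := by rw [smul_inv_smul₀ (hm p).ne']
    _ = m p ^ (α - 1) • w := by
      rw [smul_rpow h_proj.nonneg (hm p).le hα.le, rpow_of_isStarProjection h_proj hα, smul_smul,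
        Real.rpow_sub_one (hm p).ne', div_eq_mul_inv]
  rw [spectralCore, rpow_of_isStarProjection he hp, w_rpow, mul_smul_comm, smul_mul_assoc,
    rpow_conj_rpow_conj ha, norm_smul, norm_rpow_conj he, ← CFC.rpow_add ha.isUnit, h, norm_smul,
    norm_of_isStarProjection he he₀, mul_one,
    Real.norm_of_nonneg (Real.rpow_nonneg (hm p).le _), Real.norm_of_nonneg (hm _).le]
  congr 2
  ring

end Compression

end CStarAlgebra

section Matrix

open Matrix
open scoped Matrix.Norms.L2Operator

section SpectralPower

variable {ι : Type*} [Fintype ι] [DecidableEq ι] {A : Matrix ι ι ℂ}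

lemma continuousOn_spectrum (A : Matrix ι ι ℂ) (f : ℝ → ℝ) : ContinuousOn f (spectrum ℝ A) :=
  A.finite_real_spectrum.continuousOn f

lemma rpow_rpow (hA : 0 ≤ A) (x y : ℝ) : (A ^ x) ^ y = A ^ (x * y) := by
  rw [CFC.rpow_eq_cfc_real CFC.rpow_nonneg, CFC.rpow_eq_cfc_real hA, CFC.rpow_eq_cfc_real hA,
    ← cfc_comp _ _ A hA.isSelfAdjoint ((A.finite_real_spectrum.image _).continuousOn _)
      (continuousOn_spectrum A _)]
  exact cfc_congr fun t ht => (Real.rpow_mul (spectrum_nonneg_of_nonneg hA ht) x y).symm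

lemma rpow_mul_rpow (hA : 0 ≤ A) {x y : ℝ} (h : x + y ≠ 0) : A ^ x * A ^ y = A ^ (x + y) := by
  simp only [CFC.rpow_eq_cfc_real hA]
  rw [← cfc_mul _ _ A (continuousOn_spectrum A _) (continuousOn_spectrum A _)]
  exact cfc_congr fun t ht => (Real.rpow_add' (spectrum_nonneg_of_nonneg hA ht) h).symm

lemma diagonal_rpow {d : ι → ℝ} (hd : ∀ i, 0 ≤ d i) (r : ℝ) :
    (diagonal fun i => (d i : ℂ)) ^ r = diagonal fun i => ((d i ^ r : ℝ) : ℂ) := by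
  have h_nonneg : (0 : Matrix ι ι ℂ) ≤ diagonal fun i => (d i : ℂ) := by
    rw [nonneg_iff_posSemidef, posSemidef_diagonal_iff]
    simpa using hd
  obtain ⟨P, hP⟩ : ∃ P : Polynomial ℝ, ∀ i, P.eval (d i) = d i ^ r :=
    ⟨Lagrange.interpolate (Finset.univ.image d) id (· ^ r), fun i =>
      Lagrange.eval_interpolate_at_node (v := id) _ Function.injective_id.injOn
        (Finset.mem_image_of_mem d (Finset.mem_univ i))⟩
  have h_eqOn : Set.EqOn (fun x : ℝ => x ^ r) P.eval
      (spectrum ℝ (diagonal fun i => (d i : ℂ))) := fun x hx => by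
    have hx' := spectrum.algebraMap_mem ℂ hx
    rw [spectrum_diagonal] at hx'
    obtain ⟨i, hi⟩ := hx'
    obtain rfl : d i = x := by simpa using hi
    exact (hP i).symm
  calc (diagonal fun i => (d i : ℂ)) ^ r
    _ = Polynomial.aeval (diagonalAlgHom ℝ fun i => (d i : ℂ)) P := by
      rw [CFC.rpow_eq_cfc_real h_nonneg, cfc_congr h_eqOn,
        cfc_polynomial P _ h_nonneg.isSelfAdjoint]
      rfl
    _ = diagonal fun i => Polynomial.aeval (d i : ℂ) P := by
      rw [Polynomial.aeval_algHom_apply, Polynomial.aeval_pi_apply]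
      rfl
    _ = diagonal fun i => ((d i ^ r : ℝ) : ℂ) := by
      congr! 2 with i
      rw [← hP i]
      exact Polynomial.aeval_algebraMap_apply ℂ (d i) P

lemma conjStarAlgAut_rpow (U : unitaryGroup ι ℂ) (hA : 0 ≤ A) (r : ℝ) :
    (Unitary.conjStarAlgAut ℂ _ U A) ^ r = Unitary.conjStarAlgAut ℂ _ U (A ^ r) :=
  (map_rpow (Unitary.conjStarAlgAut ℂ _ U : Matrix ι ι ℂ →⋆ₐ[ℂ] Matrix ι ι ℂ) hA
    (continuousOn_spectrum A _)).symm

lemma rpow_eq_conjStarAlgAut_diagonal (hA : A.PosSemidef) (r : ℝ) :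
    A ^ r = Unitary.conjStarAlgAut ℂ _ hA.isHermitian.eigenvectorUnitary
      (diagonal fun i => ((hA.isHermitian.eigenvalues i ^ r : ℝ) : ℂ)) := by
  rw [CFC.rpow_eq_cfc_real hA.nonneg, hA.isHermitian.cfc_eq]
  rfl

lemma norm_det_rpow (hA : 0 ≤ A) (r : ℝ) : ‖(A ^ r).det‖ = ‖A.det‖ ^ r := by
  have hA' := nonneg_iff_posSemidef.mp hA
  have h_eigen (i) : 0 ≤ hA'.isHermitian.eigenvalues i := hA'.eigenvalues_nonneg i
  have h_det : ‖A.det‖ = ∏ i, hA'.isHermitian.eigenvalues i := by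
    simp [hA'.isHermitian.det_eq_prod_eigenvalues, abs_of_nonneg (h_eigen _)]
  rw [rpow_eq_conjStarAlgAut_diagonal hA', Unitary.conjStarAlgAut_apply, det_mul_right_comm,
    Unitary.mul_star_self_of_mem (SetLike.coe_mem _), one_mul, det_diagonal, h_det, norm_prod,
    ← Real.finsetProd_rpow _ _ fun i _ => h_eigen i]
  exact Finset.prod_congr rfl fun i _ => by simp [Real.rpow_nonneg (h_eigen i)]

end SpectralPower

section Compound

variable {k l m n : ℕ}

lemma exists_orderEmbedding_comp_perm {r : Fin k → Fin n} (hr : Function.Injective r) :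
    ∃ (g : Fin k ↪o Fin n) (σ : Equiv.Perm (Fin k)), r = g ∘ σ := by
  have h_mono : StrictMono (r ∘ Tuple.sort r) :=
    (Tuple.monotone_sort r).strictMono_of_injective (hr.comp (Tuple.sort r).injective)
  exact ⟨.ofStrictMono _ h_mono, (Tuple.sort r)⁻¹, by ext i; simp⟩

lemma orderEmbedding_eq_of_range_subset {f g : Fin k ↪o Fin n}
    (h : Set.range f ⊆ Set.range g) : f = g := by
  have h_card : (Set.range g).ncard ≤ (Set.range f).ncard := by
    rw [Set.ncard_range_of_injective g.injective, Set.ncard_range_of_injective f.injective]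
  exact DFunLike.coe_injective ((StrictMono.range_inj f.strictMono g.strictMono).mp
    (Set.eq_of_subset_of_ncard_le h h_card))

lemma sum_eq_sum_orderEmbedding_perm {M : Type*} [AddCommMonoid M] (F : (Fin k → Fin n) → M)
    (hF : ∀ r, ¬ Function.Injective r → F r = 0) :
    ∑ r, F r = ∑ g : Fin k ↪o Fin n, ∑ σ : Equiv.Perm (Fin k), F (g ∘ σ) := by
  rw [← Finset.sum_product']
  symm
  refine Finset.sum_of_injOn (fun x : (Fin k ↪o Fin n) × Equiv.Perm (Fin k) => x.1 ∘ x.2)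
    ?_ (by simp) ?_ (by simp)
  · rintro ⟨g, σ⟩ - ⟨g', σ'⟩ - (h : g ∘ σ = g' ∘ σ')
    obtain rfl : g = g' := orderEmbedding_eq_of_range_subset <| by
      rw [← σ.surjective.range_comp g, ← σ'.surjective.range_comp g', h]
    obtain rfl : σ = σ' := Equiv.ext fun i => g.injective (congrFun h i)
    rfl
  · intro r _ hr
    refine hF r fun h_inj => hr ?_
    obtain ⟨g, σ, rfl⟩ := exists_orderEmbedding_comp_perm h_inj
    exact ⟨(g, σ), by simp⟩

variable {R : Type*} [CommRing R]

lemma det_mul_eq_sum_prod_mul_det (A : Matrix (Fin k) (Fin n) R) (B : Matrix (Fin n) (Fin k) R) :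
    (A * B).det = ∑ r : Fin k → Fin n, (∏ i, A i (r i)) * (B.submatrix r id).det := by
  have h_rows : A * B = fun i => ∑ j, A i j • B j := by
    ext i l
    simp [mul_apply, Finset.sum_apply]
  change detRowAlternating (A * B) = _
  rw [h_rows, ← AlternatingMap.coe_multilinearMap, MultilinearMap.map_sum]
  exact Finset.sum_congr rfl fun r _ => MultilinearMap.map_smul_univ _ _ _

lemma det_mul_eq_sum_orderEmbedding (A : Matrix (Fin k) (Fin n) R)
    (B : Matrix (Fin n) (Fin k) R) :
    (A * B).det = ∑ g : Fin k ↪o Fin n, (A.submatrix id g).det * (B.submatrix g id).det := by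
  rw [det_mul_eq_sum_prod_mul_det, sum_eq_sum_orderEmbedding_perm]
  · refine Finset.sum_congr rfl fun g _ => ?_
    have det_comp (σ : Equiv.Perm (Fin k)) :
        (B.submatrix (g ∘ σ) id).det = Equiv.Perm.sign σ * (B.submatrix g id).det :=
      det_permute σ (B.submatrix g id)
    simp_rw [det_comp]
    rw [← det_transpose (A.submatrix id g), det_apply' (A.submatrix id g)ᵀ, Finset.sum_mul]
    refine Finset.sum_congr rfl fun σ _ => ?_
    simp only [Function.comp_apply, transpose_apply, submatrix_apply, id]
    ring
  · intro r hr
    obtain ⟨i, j, hij, hne⟩ := Function.not_injective_iff.mp hr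
    rw [det_zero_of_row_eq hne (by ext; simp [hij]), mul_zero]

/-- The `k`-th compound of a matrix: the matrix of its minors of order `k`, with rows and columns
indexed by the increasing `k`-tuples of indices. It represents the `k`-th exterior power of the
matrix. -/
def compound (k : ℕ) (A : Matrix (Fin m) (Fin n) R) :
    Matrix (Fin k ↪o Fin m) (Fin k ↪o Fin n) R :=
  of fun f g => (A.submatrix f g).det

lemma compound_mul (A : Matrix (Fin l) (Fin m) R) (B : Matrix (Fin m) (Fin n) R) :
    compound k (A * B) = compound k A * compound k B := by
  ext f g
  simp only [mul_apply, compound, of_apply]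
  rw [submatrix_mul A B f id g Function.bijective_id, det_mul_eq_sum_orderEmbedding]
  rfl

lemma compound_diagonal (d : Fin n → R) :
    compound k (diagonal d) = diagonal fun f : Fin k ↪o Fin n => ∏ i, d (f i) := by
  ext f g
  rw [compound, of_apply]
  rcases eq_or_ne f g with rfl | hfg
  · rw [submatrix_diagonal _ _ f.injective, det_diagonal, diagonal_apply_eq]
    rfl
  · rw [diagonal_apply_ne _ hfg]
    obtain ⟨i, hi⟩ : ∃ i, f i ∉ Set.range g := by
      by_contra! h
      exact hfg (orderEmbedding_eq_of_range_subset (Set.range_subset_iff.mpr h))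
    exact det_eq_zero_of_row_eq_zero i fun j => diagonal_apply_ne _ fun h => hi ⟨j, h.symm⟩

lemma compound_one : compound k (1 : Matrix (Fin n) (Fin n) R) = 1 := by
  simp [← diagonal_one, compound_diagonal]

lemma compound_conjTranspose [StarRing R] (A : Matrix (Fin m) (Fin n) R) :
    compound k Aᴴ = (compound k A)ᴴ := by
  ext f g
  simp only [compound, of_apply, conjTranspose_apply]
  rw [← det_conjTranspose, conjTranspose_submatrix]

/-- The compound of a unitary matrix, as a unitary matrix. -/
def compoundUnitary [StarRing R] (k : ℕ) (U : unitaryGroup (Fin n) R) :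
    unitaryGroup (Fin k ↪o Fin n) R :=
  ⟨compound k U, by
    rw [mem_unitaryGroup_iff, star_eq_conjTranspose, ← compound_conjTranspose, ← compound_mul,
      ← star_eq_conjTranspose, mem_unitaryGroup_iff.mp U.2, compound_one]⟩

variable {A : Matrix (Fin n) (Fin n) ℂ}

lemma compound_conjStarAlgAut (U : unitaryGroup (Fin n) ℂ) (A : Matrix (Fin n) (Fin n) ℂ) :
    compound k (Unitary.conjStarAlgAut ℂ _ U A) =
      Unitary.conjStarAlgAut ℂ _ (compoundUnitary k U) (compound k A) := by
  simp only [Unitary.conjStarAlgAut_apply, compound_mul, compoundUnitary,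
    star_eq_conjTranspose, compound_conjTranspose]

lemma compound_nonneg (hA : 0 ≤ A) : 0 ≤ compound k A := by
  obtain ⟨B, rfl⟩ := CStarAlgebra.nonneg_iff_eq_star_mul_self.mp hA
  rw [compound_mul, star_eq_conjTranspose, compound_conjTranspose, ← star_eq_conjTranspose]
  exact star_mul_self_nonneg _

lemma isStrictlyPositive_compound (hA : IsStrictlyPositive A) :
    IsStrictlyPositive (compound k A) := by
  obtain ⟨B, hB⟩ := hA.isUnit.exists_right_inv
  exact ⟨compound_nonneg hA.nonneg,
    IsUnit.of_mul_eq_one (compound k B) (by rw [← compound_mul, hB, compound_one])⟩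

lemma compound_rpow (hA : 0 ≤ A) (r : ℝ) : compound k (A ^ r) = compound k A ^ r := by
  have hA' := nonneg_iff_posSemidef.mp hA
  set U := hA'.isHermitian.eigenvectorUnitary
  set d := hA'.isHermitian.eigenvalues with d_def
  have hd (i) : 0 ≤ d i := hA'.eigenvalues_nonneg i
  have h_prod (f : Fin k ↪o Fin n) : 0 ≤ ∏ i, d (f i) := Finset.prod_nonneg fun i _ => hd _
  have h_compound : compound k A = Unitary.conjStarAlgAut ℂ _ (compoundUnitary k U)
      (diagonal fun f => ((∏ i, d (f i) : ℝ) : ℂ)) := by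
    conv_lhs => rw [hA'.isHermitian.spectral_theorem]
    rw [compound_conjStarAlgAut, compound_diagonal]
    simp [d_def, U]
  have h_diag_nonneg : (0 : Matrix (Fin k ↪o Fin n) (Fin k ↪o Fin n) ℂ) ≤
      diagonal fun f => ((∏ i, d (f i) : ℝ) : ℂ) := by
    rw [nonneg_iff_posSemidef, posSemidef_diagonal_iff]
    exact fun f => Complex.zero_le_real.mpr (h_prod f)
  rw [rpow_eq_conjStarAlgAut_diagonal hA', compound_conjStarAlgAut, compound_diagonal, h_compound,
    conjStarAlgAut_rpow _ h_diag_nonneg, diagonal_rpow h_prod]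
  congr! 3 with f
  rw [← Real.finsetProd_rpow _ _ fun i _ => hd _]
  push_cast
  rfl

lemma val_le_val_of_strictMono {f : Fin k → Fin n} (hf : StrictMono f) (i : Fin k) :
    (i : ℕ) ≤ f i := calc
  (i : ℕ) = ((Finset.Iio i).image f).card := by
    rw [Finset.card_image_of_injective _ hf.injective, Fin.card_Iio]
  _ ≤ (Finset.Iio (f i)).card :=
    Finset.card_le_card <| Finset.image_subset_iff.mpr fun j hj => by
      simpa using hf (by simpa using hj)
  _ = f i := Fin.card_Iio _

lemma prod_le_prod_castLE_of_antitone {d : Fin n → ℝ} (hd : Antitone d) (hd₀ : ∀ i, 0 ≤ d i)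
    (hk : k ≤ n) {r : Fin k → Fin n} (hr : Function.Injective r) :
    ∏ i, d (r i) ≤ ∏ i : Fin k, d (Fin.castLE hk i) := by
  obtain ⟨g, σ, rfl⟩ := exists_orderEmbedding_comp_perm hr
  refine (Equiv.prod_comp σ fun i => d (g i)).trans_le ?_
  exact Finset.prod_le_prod (fun i _ => hd₀ _) fun i _ =>
    hd (Fin.le_def.mpr (val_le_val_of_strictMono g.strictMono i))

lemma prod_Iic_eq_prod_castLE {M : Type*} [CommMonoid M] (d : Fin n → M) (i : Fin n) :
    ∏ j ∈ Finset.Iic i, d j = ∏ j : Fin (i + 1), d (Fin.castLE i.2 j) := by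
  have h_Iic : Finset.Iic i = Finset.univ.map (Fin.castLEEmb i.2) := by
    ext j
    simp only [Finset.mem_Iic, Finset.mem_map, Finset.mem_univ, true_and, Fin.castLEEmb_apply]
    constructor
    · exact fun h => ⟨⟨j, Nat.lt_succ_of_le h⟩, rfl⟩
    · rintro ⟨a, rfl⟩
      exact Nat.le_of_lt_succ a.2
  rw [h_Iic, Finset.prod_map]
  rfl

lemma norm_eq_norm_eigenvalues (hA : A.PosSemidef) : ‖A‖ = ‖hA.isHermitian.eigenvalues‖ := by
  conv_lhs => rw [hA.isHermitian.spectral_theorem, StarAlgEquiv.norm_map, l2_opNorm_diagonal]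
  simp [Pi.norm_def]

lemma norm_compound_eq_pi_norm (hA : A.PosSemidef) :
    ‖compound k A‖ = ‖fun f : Fin k ↪o Fin n => ∏ i, hA.isHermitian.eigenvalues (f i)‖ := by
  conv_lhs => rw [hA.isHermitian.spectral_theorem, compound_conjStarAlgAut,
    StarAlgEquiv.norm_map, compound_diagonal, l2_opNorm_diagonal]
  simp [Pi.norm_def, nnnorm_prod]

lemma norm_compound_one (hA : A.PosSemidef) : ‖compound 1 A‖ = ‖A‖ := by
  rw [norm_eq_norm_eigenvalues hA, norm_compound_eq_pi_norm hA]
  simp only [Finset.univ_unique, Finset.prod_singleton]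
  refine le_antisymm ?_ ?_ <;> refine (pi_norm_le_iff_of_nonneg (norm_nonneg _)).mpr ?_
  · exact fun f => norm_le_pi_norm hA.isHermitian.eigenvalues _
  · exact fun i => norm_le_pi_norm
      (fun f : Fin 1 ↪o Fin n => hA.isHermitian.eigenvalues (f default))
      (OrderEmbedding.ofStrictMono (fun _ => i) (Subsingleton.strictMono _))

lemma norm_compound (hA : A.PosSemidef) (i : Fin (Fintype.card (Fin n))) :
    ‖compound (i + 1) A‖ = ∏ j ∈ Finset.Iic i, hA.isHermitian.eigenvalues₀ j := by
  let e : Fin n ≃ Fin (Fintype.card (Fin n)) := (Fintype.equivOfCardEq (Fintype.card_fin _)).symm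
  set d := hA.isHermitian.eigenvalues₀
  have hd₀ (j) : 0 ≤ d j := by
    simpa [IsHermitian.eigenvalues, e, d] using hA.eigenvalues_nonneg (e.symm j)
  have h_prod {k} (r : Fin k → Fin (Fintype.card (Fin n))) : ‖∏ j, d (r j)‖ = ∏ j, d (r j) :=
    Real.norm_of_nonneg (Finset.prod_nonneg fun j _ => hd₀ _)
  rw [prod_Iic_eq_prod_castLE, norm_compound_eq_pi_norm hA]
  change ‖fun f : Fin (i + 1) ↪o Fin n => ∏ j, d (e (f j))‖ = _
  refine le_antisymm ?_ ?_
  · refine (pi_norm_le_iff_of_nonneg (Finset.prod_nonneg fun j _ => hd₀ _)).mpr fun f => ?_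
    rw [h_prod fun j => e (f j)]
    exact prod_le_prod_castLE_of_antitone hA.isHermitian.eigenvalues₀_antitone hd₀ i.2
      (e.injective.comp f.injective)
  · obtain ⟨g, σ, hg⟩ := exists_orderEmbedding_comp_perm
      (e.symm.injective.comp (Fin.castLE_injective i.2))
    calc ∏ j, d (Fin.castLE i.2 j) = ∏ j, d (e (g (σ j))) :=
          Finset.prod_congr rfl fun j _ => by rw [← Function.comp_apply (f := g), ← hg]; simp
      _ = ‖∏ j, d (e (g j))‖ := by
          rw [h_prod fun j => e (g j), Equiv.prod_comp σ fun j => d (e (g j))]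
      _ ≤ _ := norm_le_pi_norm (fun f : Fin (i + 1) ↪o Fin n => ∏ j, d (e (f j))) g

lemma prod_eigenvalues₀ (hA : A.PosSemidef) :
    ∏ i, hA.isHermitian.eigenvalues₀ i = ‖A.det‖ := by
  rw [hA.isHermitian.det_eq_prod_eigenvalues, norm_prod]
  simp only [RCLike.norm_of_nonneg (hA.eigenvalues_nonneg _)]
  exact (Equiv.prod_comp _ _).symm

end Compound

section Means

variable {k n : ℕ}

lemma logMajorizedBy_of_norm_compound_le {X Y : Matrix (Fin n) (Fin n) ℂ} (hX : 0 ≤ X)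
    (hY : 0 ≤ Y) (h : ∀ k, ‖compound k X‖ ≤ ‖compound k Y‖) (h_det : ‖X.det‖ = ‖Y.det‖) :
    LogMajorizedBy X Y := by
  have hX' := nonneg_iff_posSemidef.mp hX
  have hY' := nonneg_iff_posSemidef.mp hY
  refine ⟨hX', hY', fun k => ?_, ?_⟩
  · rw [← norm_compound hX', ← norm_compound hY']
    exact h _
  · rw [prod_eigenvalues₀ hX', prod_eigenvalues₀ hY', h_det]

lemma LogMajorizedBy.norm_le {X Y : Matrix (Fin n) (Fin n) ℂ} [NeZero n]
    (h : LogMajorizedBy X Y) : ‖X‖ ≤ ‖Y‖ := by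
  obtain ⟨hX, hY, h_prod, -⟩ := h
  have h_zero := h_prod ⟨0, by simp [NeZero.pos n]⟩
  rwa [← norm_compound hX, ← norm_compound hY, zero_add, norm_compound_one hX,
    norm_compound_one hY] at h_zero

variable {A B : Matrix (Fin n) (Fin n) ℂ}

lemma renyiMean_eq (α q : ℝ) (A B : Matrix (Fin n) (Fin n) ℂ) :
    renyiMean α q A B = renyiCore α q A B ^ (1 / q) := rfl

lemma renyiMean_nonneg (α q : ℝ) (A B : Matrix (Fin n) (Fin n) ℂ) : 0 ≤ renyiMean α q A B :=
  CFC.rpow_nonneg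

lemma quasiSpectralMean_nonneg (α p : ℝ) (A B : Matrix (Fin n) (Fin n) ℂ) :
    0 ≤ quasiSpectralMean α p A B := CFC.rpow_nonneg

lemma compound_renyiCore (α q : ℝ) (hA : 0 ≤ A) (hB : 0 ≤ B) :
    compound k (renyiCore α q A B) = renyiCore α q (compound k A) (compound k B) := by
  simp only [renyiCore, compound_mul, compound_rpow hA, compound_rpow hB]

lemma compound_spectralCore (α p : ℝ) (hA : 0 ≤ A) (hB : 0 ≤ B) :
    compound k (spectralCore α p A B) = spectralCore α p (compound k A) (compound k B) := by
  have h_nonneg : 0 ≤ A ^ (p / 2) * B ^ p * A ^ (p / 2) :=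
    conjugate_nonneg_of_nonneg CFC.rpow_nonneg CFC.rpow_nonneg
  simp only [spectralCore, compound_mul, compound_rpow hA, compound_rpow hB,
    compound_rpow h_nonneg]

lemma norm_compound_rpow {X : Matrix (Fin n) (Fin n) ℂ} (hX : 0 ≤ X) {r : ℝ} (hr : 0 < r) :
    ‖compound k (X ^ r)‖ = ‖compound k X‖ ^ r := by
  rw [compound_rpow hX, CFC.norm_rpow _ hr (compound_nonneg hX)]

lemma norm_compound_renyiMean {α q : ℝ} (hq : 0 < q) (hA : 0 ≤ A) (hB : 0 ≤ B) :
    ‖compound k (renyiMean α q A B)‖ =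
      ‖renyiCore α q (compound k A) (compound k B)‖ ^ (1 / q) := by
  rw [renyiMean_eq, norm_compound_rpow (renyiCore_nonneg α q A B) (by positivity),
    compound_renyiCore α q hA hB]

lemma exists_quasiSpectralMean_eq (α p : ℝ) (hA : IsStrictlyPositive A)
    (B : Matrix (Fin n) (Fin n) ℂ) :
    ∃ T, quasiSpectralMean α p A B = (Tᴴ * T) ^ (1 / p) ∧ spectralCore α p A B = T * Tᴴ := by
  set G := geomMean α ((A ^ p) ^ (-1 : ℝ)) (B ^ p) with G_def
  have hG : 0 ≤ G := conjugate_nonneg_of_nonneg CFC.rpow_nonneg CFC.rpow_nonneg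
  have G_eq : G = A ^ (-(p / 2)) * (A ^ (p / 2) * B ^ p * A ^ (p / 2)) ^ α * A ^ (-(p / 2)) := by
    rw [G_def, geomMean]
    simp only [rpow_rpow_of_isStrictlyPositive hA]
    ring_nf
  have hT : (A ^ ((1 - α) * p) * G ^ (1 / 2 : ℝ))ᴴ = G ^ (1 / 2 : ℝ) * A ^ ((1 - α) * p) := by
    rw [← star_eq_conjTranspose, star_mul, CFC.rpow_nonneg.isSelfAdjoint,
      CFC.rpow_nonneg.isSelfAdjoint]
  refine ⟨A ^ ((1 - α) * p) * G ^ (1 / 2 : ℝ), ?_, ?_⟩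
  · have h_pow : (A ^ p) ^ (2 * (1 - α)) = A ^ ((1 - α) * p) * A ^ ((1 - α) * p) := by
      rw [rpow_rpow_of_isStrictlyPositive hA, ← CFC.rpow_add hA.isUnit]
      ring_nf
    rw [quasiSpectralMean, spectralMean, hT, h_pow]
    simp only [G_def, mul_assoc]
  · have h_sqrt : G ^ (1 / 2 : ℝ) * G ^ (1 / 2 : ℝ) = G := by
      rw [rpow_mul_rpow hG (by norm_num), add_halves, CFC.rpow_one G]
    calc spectralCore α p A B = A ^ ((1 - α) * p) * G * A ^ ((1 - α) * p) := by
          rw [G_eq, rpow_conj_rpow_conj hA, spectralCore]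
          ring_nf
      _ = _ := by
          rw [hT]
          nth_rw 1 [← h_sqrt]
          simp only [mul_assoc]

lemma norm_compound_quasiSpectralMean {α p : ℝ} (hp : 0 < p) (hA : IsStrictlyPositive A)
    (hB : 0 ≤ B) :
    ‖compound k (quasiSpectralMean α p A B)‖ =
      ‖spectralCore α p (compound k A) (compound k B)‖ ^ (1 / p) := by
  obtain ⟨T, h_mean, h_core⟩ := exists_quasiSpectralMean_eq α p hA B
  rw [h_mean, norm_compound_rpow (posSemidef_conjTranspose_mul_self T).nonneg (by positivity),
    ← compound_spectralCore α p hA.nonneg hB, h_core]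
  rw [compound_mul, compound_mul, compound_conjTranspose, ← star_eq_conjTranspose,
    CStarRing.norm_star_mul_self, CStarRing.norm_self_mul_star]

lemma norm_det_renyiCore {α q : ℝ} (hA : IsStrictlyPositive A) (hB : 0 ≤ B) :
    ‖(renyiCore α q A B).det‖ = (‖A.det‖ ^ (1 - α) * ‖B.det‖ ^ α) ^ q := by
  have h_det : 0 < ‖A.det‖ := norm_pos_iff.mpr ((isUnit_iff_isUnit_det A).mp hA.isUnit).ne_zero
  rw [renyiCore, det_mul, det_mul, norm_mul, norm_mul, norm_det_rpow hA.nonneg,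
    norm_det_rpow hB, mul_right_comm, ← Real.rpow_add h_det,
    Real.mul_rpow (by positivity) (by positivity), ← Real.rpow_mul h_det.le,
    ← Real.rpow_mul (norm_nonneg _)]
  ring_nf

lemma norm_det_spectralCore {α p : ℝ} (hA : IsStrictlyPositive A) (hB : 0 ≤ B) :
    ‖(spectralCore α p A B).det‖ = (‖A.det‖ ^ (1 - α) * ‖B.det‖ ^ α) ^ p := by
  have h_det : 0 < ‖A.det‖ := norm_pos_iff.mpr ((isUnit_iff_isUnit_det A).mp hA.isUnit).ne_zero
  have h_nonneg : 0 ≤ A ^ (p / 2) * B ^ p * A ^ (p / 2) :=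
    conjugate_nonneg_of_nonneg CFC.rpow_nonneg CFC.rpow_nonneg
  simp only [spectralCore, det_mul, norm_mul, norm_det_rpow hA.nonneg, norm_det_rpow hB,
    norm_det_rpow h_nonneg]
  rw [mul_right_comm, ← Real.rpow_add h_det, mul_right_comm, ← Real.rpow_add h_det]
  simp only [Real.mul_rpow (Real.rpow_nonneg (norm_nonneg _) _)
    (Real.rpow_nonneg (norm_nonneg _) _),
    ← Real.rpow_mul (norm_nonneg _), ← mul_assoc, ← Real.rpow_add h_det]
  ring_nf

lemma norm_det_renyiMean {α q : ℝ} (hq : 0 < q) (hA : IsStrictlyPositive A) (hB : 0 ≤ B) :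
    ‖(renyiMean α q A B).det‖ = ‖A.det‖ ^ (1 - α) * ‖B.det‖ ^ α := by
  rw [renyiMean_eq, norm_det_rpow (renyiCore_nonneg α q A B), norm_det_renyiCore hA hB,
    one_div, Real.rpow_rpow_inv (by positivity) hq.ne']

lemma norm_det_quasiSpectralMean {α p : ℝ} (hp : 0 < p) (hA : IsStrictlyPositive A)
    (hB : 0 ≤ B) :
    ‖(quasiSpectralMean α p A B).det‖ = ‖A.det‖ ^ (1 - α) * ‖B.det‖ ^ α := by
  obtain ⟨T, h_mean, h_core⟩ := exists_quasiSpectralMean_eq α p hA B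
  rw [h_mean, norm_det_rpow (posSemidef_conjTranspose_mul_self T).nonneg, det_mul_comm, ← h_core,
    norm_det_spectralCore hA hB, one_div, Real.rpow_rpow_inv (by positivity) hp.ne']

lemma quasiSpectralMean_logMajorizedBy_renyiMean_of_isStrictlyPositive
    (hA : IsStrictlyPositive A) (hB : 0 ≤ B) {α p q : ℝ} (hα₀ : 0 < α) (hα₁ : α ≤ 1)
    (hp : 0 < p) (hq : 0 < q) (hpq : p ≤ α * q) :
    LogMajorizedBy (quasiSpectralMean α p A B) (renyiMean α q A B) := by
  refine logMajorizedBy_of_norm_compound_le (quasiSpectralMean_nonneg α p A B)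
    (renyiMean_nonneg α q A B) (fun k => ?_)
    (by rw [norm_det_quasiSpectralMean hp hA hB, norm_det_renyiMean hq hA hB])
  rw [norm_compound_quasiSpectralMean hp hA hB, norm_compound_renyiMean hq hA.nonneg hB, one_div,
    Real.rpow_inv_le_iff_of_pos (by positivity) (by positivity) hp, ← Real.rpow_mul (norm_nonneg _),
    one_div_mul_eq_div]
  exact norm_spectralCore_le (isStrictlyPositive_compound hA) (compound_nonneg hB) hα₀ hα₁ hp hq hpq

lemma renyiMean_logMajorizedBy_quasiSpectralMean_of_isStrictlyPositive
    (hA : IsStrictlyPositive A) (hB : 0 ≤ B) {α p q : ℝ} (hα₀ : 0 < α) (hα₁ : α ≤ 1 / 2)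
    (hq : 0 < q) (hqp : q ≤ p) :
    LogMajorizedBy (renyiMean α q A B) (quasiSpectralMean α p A B) := by
  have hp : 0 < p := hq.trans_le hqp
  refine logMajorizedBy_of_norm_compound_le (renyiMean_nonneg α q A B)
    (quasiSpectralMean_nonneg α p A B) (fun k => ?_)
    (by rw [norm_det_quasiSpectralMean hp hA hB, norm_det_renyiMean hq hA hB])
  rw [norm_compound_quasiSpectralMean hp hA hB, norm_compound_renyiMean hq hA.nonneg hB, one_div,
    Real.rpow_inv_le_iff_of_pos (by positivity) (by positivity) hq, ← Real.rpow_mul (norm_nonneg _),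
    one_div_mul_eq_div]
  exact norm_renyiCore_le (isStrictlyPositive_compound hA) (compound_nonneg hB) hα₀ hα₁ hq hqp

end Means

section Support

variable {ι : Type*} [Fintype ι] [DecidableEq ι] {A C D Q : Matrix ι ι ℂ}

lemma mul_rpow_of_mul_eq (hC : 0 ≤ C) (h : Q * C = C) {r : ℝ} (hr : r ≠ 0) :
    Q * C ^ r = C ^ r := by
  have h_factor : C ^ r = C * C ^ (r - 1) := by
    nth_rw 2 [← CFC.rpow_one C hC]
    rw [rpow_mul_rpow hC (by rwa [add_sub_cancel]), add_sub_cancel]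
  rw [h_factor, ← mul_assoc, h]

-- With `P` the orthogonal projection onto the kernel of `A`, take `D = A + P` and `Q = 1 - P`.
lemma exists_isStrictlyPositive_rpow_mul_eq_rpow (hA : 0 ≤ A) :
    ∃ D Q : Matrix ι ι ℂ, IsStrictlyPositive D ∧ IsStarProjection Q ∧
      ∀ r : ℝ, r ≠ 0 → D ^ r * Q = A ^ r := by
  have hA' : IsSelfAdjoint A := hA.isSelfAdjoint
  set f : ℝ → ℝ := fun x => if x = 0 then 1 else x with f_def
  set g : ℝ → ℝ := fun x => if x = 0 then 0 else 1 with g_def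
  have f_pos : ∀ x ∈ spectrum ℝ A, 0 < f x := fun x hx => by
    have := spectrum_nonneg_of_nonneg hA hx
    grind
  refine ⟨cfc f A, cfc g A, ?_, ⟨?_, cfc_predicate g A⟩, fun r hr => ?_⟩
  · exact (cfc_isStrictlyPositive_iff f A (continuousOn_spectrum A f)).mpr f_pos
  · rw [IsIdempotentElem, ← cfc_mul _ _ A (continuousOn_spectrum A _) (continuousOn_spectrum A _)]
    exact cfc_congr fun x _ => by simp [g_def]
  · rw [CFC.cfc_rpow f_pos (continuousOn_spectrum A f) hA', CFC.rpow_eq_cfc_real hA,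
      ← cfc_mul _ _ A (continuousOn_spectrum A _) (continuousOn_spectrum A _)]
    refine cfc_congr fun x _ => ?_
    by_cases hx : x = 0 <;> simp [f_def, g_def, hx, Real.zero_rpow hr]

lemma mul_rpow_eq_rpow (hQ : IsSelfAdjoint Q) (h : ∀ r : ℝ, r ≠ 0 → D ^ r * Q = A ^ r) {r : ℝ}
    (hr : r ≠ 0) : Q * D ^ r = A ^ r := by
  have h_star (X : Matrix ι ι ℂ) : star (X ^ r) = X ^ r := CFC.rpow_nonneg.isSelfAdjoint
  simpa only [star_mul, hQ.star_eq, h_star] using congr_arg star (h r hr)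

lemma rpow_conj_eq_rpow_conj (hQ : IsSelfAdjoint Q) (h : ∀ r : ℝ, r ≠ 0 → D ^ r * Q = A ^ r)
    (hC : IsSelfAdjoint C) (hQC : Q * C = C) {r : ℝ} (hr : r ≠ 0) :
    A ^ r * C * A ^ r = D ^ r * C * D ^ r := by
  have hCQ : C * Q = C := by
    simpa only [star_mul, hQ.star_eq, hC.star_eq] using congr_arg star hQC
  nth_rw 1 [← h r hr]
  rw [← mul_rpow_eq_rpow hQ h hr, mul_assoc (D ^ r), hQC, ← mul_assoc, mul_assoc (D ^ r), hCQ]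

lemma mul_rpow_conj (hQ : IsSelfAdjoint Q) (h : ∀ r : ℝ, r ≠ 0 → D ^ r * Q = A ^ r)
    (hQC : Q * C = C) {r : ℝ} (hr : r ≠ 0) : Q * (D ^ r * C * D ^ r) = D ^ r * C * D ^ r := by
  rw [← mul_assoc, ← mul_assoc, mul_rpow_eq_rpow hQ h hr, ← h r hr, mul_assoc (D ^ r), hQC]

variable {n : ℕ} {A B D Q : Matrix (Fin n) (Fin n) ℂ}

lemma mul_eq_zero_of_supportProj_le (h : supportProj B ≤ supportProj A)
    {M : Matrix (Fin n) (Fin n) ℂ} (hM : A * M = 0) : B * M = 0 := by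
  have h_ker : LinearMap.ker (toEuclideanLin A) ≤ LinearMap.ker (toEuclideanLin B) := by
    rw [supportProj, supportProj, Submodule.starProjection_le_starProjection_iff] at h
    simpa only [Submodule.orthogonal_orthogonal] using Submodule.orthogonal_le h
  refine toEuclideanLin.injective (LinearMap.ext fun v => ?_)
  have hv : toEuclideanLin M v ∈ LinearMap.ker (toEuclideanLin A) := by
    simp [LinearMap.mem_ker, toLpLin_apply, mulVec_mulVec, hM]
  simpa [toLpLin_apply, mulVec_mulVec] using h_ker hv

lemma supportProj_le_of_isUnit (hA : IsUnit A) (B : Matrix (Fin n) (Fin n) ℂ) :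
    supportProj B ≤ supportProj A := by
  have h_ker : LinearMap.ker (toEuclideanLin A) = ⊥ := by
    refine LinearMap.ker_eq_bot'.mpr fun v hv => ?_
    have h_mulVec : A *ᵥ v.ofLp = 0 := congr_arg WithLp.ofLp hv
    exact congr_arg (WithLp.toLp 2)
      (mulVec_injective_of_isUnit hA (h_mulVec.trans (mulVec_zero A).symm))
  rw [supportProj, supportProj, Submodule.starProjection_le_starProjection_iff, h_ker,
    Submodule.bot_orthogonal_eq_top]
  exact le_top

lemma renyiMean_eq_of_rpow_mul_eq_rpow (hQ : IsSelfAdjoint Q)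
    (h : ∀ r : ℝ, r ≠ 0 → D ^ r * Q = A ^ r) (hB : 0 ≤ B) (hQB : Q * B = B) {α q : ℝ}
    (hα₀ : α ≠ 0) (hα₁ : α ≠ 1) (hq : q ≠ 0) : renyiMean α q A B = renyiMean α q D B := by
  have : 1 - α ≠ 0 := sub_ne_zero.mpr hα₁.symm
  rw [renyiMean, renyiMean, rpow_conj_eq_rpow_conj hQ h CFC.rpow_nonneg.isSelfAdjoint
    (mul_rpow_of_mul_eq hB hQB (by positivity)) (by positivity)]

lemma quasiSpectralMean_eq_of_rpow_mul_eq_rpow (hA : 0 ≤ A) (hD : 0 ≤ D) (hQ : IsSelfAdjoint Q)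
    (h : ∀ r : ℝ, r ≠ 0 → D ^ r * Q = A ^ r) (hB : 0 ≤ B) (hQB : Q * B = B) {α p : ℝ}
    (hα₀ : α ≠ 0) (hα₁ : α ≠ 1) (hp : p ≠ 0) :
    quasiSpectralMean α p A B = quasiSpectralMean α p D B := by
  have : 1 - α ≠ 0 := sub_ne_zero.mpr hα₁.symm
  set C := D ^ (p * -1 * -(1 / 2)) * B ^ p * D ^ (p * -1 * -(1 / 2)) with C_def
  have hC : 0 ≤ C := conjugate_nonneg_of_nonneg CFC.rpow_nonneg CFC.rpow_nonneg
  have hQBp : Q * B ^ p = B ^ p := mul_rpow_of_mul_eq hB hQB hp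
  have hQC : Q * C ^ α = C ^ α := mul_rpow_of_mul_eq hC (mul_rpow_conj hQ h hQBp (by simpa)) hα₀
  set G := D ^ (p * -1 * (1 / 2)) * C ^ α * D ^ (p * -1 * (1 / 2)) with G_def
  have hG : 0 ≤ G := conjugate_nonneg_of_nonneg CFC.rpow_nonneg CFC.rpow_nonneg
  have geomMean_D : geomMean α ((D ^ p) ^ (-1 : ℝ)) (B ^ p) = G := by
    simp only [geomMean, rpow_rpow hD, G_def, C_def]
  have geomMean_A : geomMean α ((A ^ p) ^ (-1 : ℝ)) (B ^ p) = G := by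
    simp only [geomMean, rpow_rpow hA]
    rw [rpow_conj_eq_rpow_conj hQ h CFC.rpow_nonneg.isSelfAdjoint hQBp (by simpa), ← C_def,
      rpow_conj_eq_rpow_conj hQ h CFC.rpow_nonneg.isSelfAdjoint hQC (by simpa)]
  have hQG : Q * G ^ (1 / 2 : ℝ) = G ^ (1 / 2 : ℝ) :=
    mul_rpow_of_mul_eq hG (mul_rpow_conj hQ h hQC (by simpa)) (by norm_num)
  rw [quasiSpectralMean, quasiSpectralMean, spectralMean, spectralMean, geomMean_A, geomMean_D,
    rpow_rpow hA, rpow_rpow hD, ← h _ (by positivity), ← mul_assoc, mul_assoc _ Q, hQG]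

lemma exists_isStrictlyPositive_means_eq (hA : 0 ≤ A) (hB : 0 ≤ B)
    (h : supportProj B ≤ supportProj A) :
    ∃ D : Matrix (Fin n) (Fin n) ℂ, IsStrictlyPositive D ∧ ∀ α : ℝ, α ≠ 0 → α ≠ 1 →
      (∀ p : ℝ, p ≠ 0 → quasiSpectralMean α p A B = quasiSpectralMean α p D B) ∧
      ∀ q : ℝ, q ≠ 0 → renyiMean α q A B = renyiMean α q D B := by
  obtain ⟨D, Q, hD, hQ, h_rpow⟩ := exists_isStrictlyPositive_rpow_mul_eq_rpow hA
  have hAQ : A * Q = A := by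
    rw [← CFC.rpow_one A hA, ← h_rpow 1 one_ne_zero, mul_assoc, hQ.isIdempotentElem.eq]
  have hBQ : B * Q = B := by
    have h_zero : B * (1 - Q) = 0 :=
      mul_eq_zero_of_supportProj_le h (by rw [mul_sub, mul_one, hAQ, sub_self])
    rwa [mul_sub, mul_one, sub_eq_zero, eq_comm] at h_zero
  have hQB : Q * B = B := by
    simpa only [star_mul, hQ.isSelfAdjoint.star_eq, hB.isSelfAdjoint.star_eq] using
      congr_arg star hBQ
  exact ⟨D, hD, fun α hα₀ hα₁ =>
    ⟨fun p hp => quasiSpectralMean_eq_of_rpow_mul_eq_rpow hA hD.nonneg hQ.isSelfAdjoint h_rpow hB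
      hQB hα₀ hα₁ hp,
    fun q hq => renyiMean_eq_of_rpow_mul_eq_rpow hQ.isSelfAdjoint h_rpow hB hQB hα₀ hα₁ hq⟩⟩

end Support

section Sufficiency

variable {n : ℕ} {A B : Matrix (Fin n) (Fin n) ℂ} {α p q : ℝ}

theorem quasiSpectralMean_logMajorizedBy_renyiMean (hα₀ : 0 < α) (hα₁ : α < 1) (hp : 0 < p)
    (hq : 0 < q) (hpq : p / q ≤ α) (hA : 0 ≤ A) (hB : 0 ≤ B)
    (h : supportProj B ≤ supportProj A) :
    LogMajorizedBy (quasiSpectralMean α p A B) (renyiMean α q A B) := by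
  obtain ⟨D, hD, h_eq⟩ := exists_isStrictlyPositive_means_eq hA hB h
  obtain ⟨h_spectral, h_renyi⟩ := h_eq α hα₀.ne' hα₁.ne
  rw [h_spectral p hp.ne', h_renyi q hq.ne']
  exact quasiSpectralMean_logMajorizedBy_renyiMean_of_isStrictlyPositive hD hB hα₀ hα₁.le hp hq
    ((div_le_iff₀ hq).mp hpq)

theorem renyiMean_logMajorizedBy_quasiSpectralMean (hα₀ : 0 < α) (hα₁ : α ≤ 1 / 2) (hq : 0 < q)
    (hqp : q ≤ p) (hA : 0 ≤ A) (hB : 0 ≤ B) (h : supportProj B ≤ supportProj A) :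
    LogMajorizedBy (renyiMean α q A B) (quasiSpectralMean α p A B) := by
  obtain ⟨D, hD, h_eq⟩ := exists_isStrictlyPositive_means_eq hA hB h
  obtain ⟨h_spectral, h_renyi⟩ := h_eq α hα₀.ne' (by linarith)
  rw [h_spectral p (hq.trans_le hqp).ne', h_renyi q hq.ne']
  exact renyiMean_logMajorizedBy_quasiSpectralMean_of_isStrictlyPositive hD hB hα₀ hα₁ hq hqp

end Sufficiency

section Necessity

variable {n : ℕ} {A B : Matrix (Fin n) (Fin n) ℂ} {α p q : ℝ}

lemma norm_renyiMean (hq : 0 < q) (A B : Matrix (Fin n) (Fin n) ℂ) :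
    ‖renyiMean α q A B‖ = ‖renyiCore α q A B‖ ^ (1 / q) := by
  rw [renyiMean_eq, CFC.norm_rpow _ (by positivity) (renyiCore_nonneg α q A B)]

lemma norm_quasiSpectralMean (hp : 0 < p) (hA : IsStrictlyPositive A)
    (B : Matrix (Fin n) (Fin n) ℂ) :
    ‖quasiSpectralMean α p A B‖ = ‖spectralCore α p A B‖ ^ (1 / p) := by
  obtain ⟨T, h_mean, h_core⟩ := exists_quasiSpectralMean_eq α p hA B
  rw [h_mean, h_core, CFC.norm_rpow _ (by positivity) (posSemidef_conjTranspose_mul_self T).nonneg,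
    ← star_eq_conjTranspose, CStarRing.norm_star_mul_self, CStarRing.norm_self_mul_star]

lemma continuousOn_norm_renyiMean (hα : 0 < α) (hq : 0 < q) (A : Matrix (Fin n) (Fin n) ℂ) :
    ContinuousOn (fun B => ‖renyiMean α q A B‖) {B | 0 ≤ B} := by
  simp only [norm_renyiMean hq]
  exact (continuousOn_renyiCore A hα hq).norm.rpow_const fun _ _ => .inr (by positivity)

lemma continuousOn_norm_quasiSpectralMean (hα : 0 < α) (hp : 0 < p) (hA : IsStrictlyPositive A) :
    ContinuousOn (fun B => ‖quasiSpectralMean α p A B‖) {B | 0 ≤ B} := by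
  simp only [norm_quasiSpectralMean hp hA]
  exact (continuousOn_spectralCore A hα hp).norm.rpow_const fun _ _ => .inr (by positivity)

lemma isStarProjection_vecMulVec {ι : Type*} [Fintype ι] {v : ι → ℂ} (hv : star v ⬝ᵥ v = 1) :
    IsStarProjection (vecMulVec v (star v)) where
  isIdempotentElem := by rw [IsIdempotentElem, vecMulVec_mul_vecMulVec, hv, one_smul]
  isSelfAdjoint := (posSemidef_vecMulVec_self_star v).isHermitian

lemma vecMulVec_mul_mul_vecMulVec {ι : Type*} [Fintype ι] (v : ι → ℂ) (M : Matrix ι ι ℂ) :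
    vecMulVec v (star v) * M * vecMulVec v (star v) =
      (star v ⬝ᵥ M *ᵥ v) • vecMulVec v (star v) := by
  rw [vecMulVec_mul, vecMulVec_mul_vecMulVec, ← dotProduct_mulVec, vecMulVec_smul]

/-- The `r`-th moment `⟨v, A ^ r v⟩ = s + (1 - s) t ^ r` of `A = diag(1, t)` at the unit vector
`v = (√s, √(1 - s))`. -/
def twoPointMoment (s t r : ℝ) : ℝ := s + (1 - s) * t ^ r

lemma twoPointMoment_pos {s t : ℝ} (hs₀ : 0 < s) (hs₁ : s ≤ 1) (ht : 0 < t) (r : ℝ) :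
    0 < twoPointMoment s t r :=
  add_pos_of_pos_of_nonneg hs₀ (mul_nonneg (sub_nonneg.mpr hs₁) (Real.rpow_nonneg ht.le r))

lemma exists_isStarProjection_rpow_compression {s t : ℝ} (hs₀ : 0 ≤ s) (hs₁ : s ≤ 1)
    (ht : 0 < t) :
    ∃ A E : Matrix (Fin 2) (Fin 2) ℂ, IsStrictlyPositive A ∧ IsStarProjection E ∧ E ≠ 0 ∧
      ∀ r : ℝ, E * A ^ r * E = twoPointMoment s t r • E := by
  set d : Fin 2 → ℝ := ![1, t] with d_def
  have hd : ∀ i, 0 < d i := Fin.forall_fin_two.mpr ⟨one_pos, ht⟩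
  set v : Fin 2 → ℂ := ![(√s : ℂ), (√(1 - s) : ℂ)] with v_def
  have h_sq {x : ℝ} (hx : 0 ≤ x) : (√x : ℂ) * √x = x := by
    rw [← Complex.ofReal_mul, Real.mul_self_sqrt hx]
  have h_moment (c : Fin 2 → ℝ) : star v ⬝ᵥ diagonal (fun i => (c i : ℂ)) *ᵥ v =
      ((s * c 0 + (1 - s) * c 1 : ℝ) : ℂ) := by
    simp only [dotProduct, mulVec_diagonal, Fin.sum_univ_two, v_def, Pi.star_apply,
      cons_val_zero, cons_val_one, RCLike.star_def, Complex.conj_ofReal]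
    rw [Complex.ofReal_add, Complex.ofReal_mul, Complex.ofReal_mul]
    linear_combination (c 0 : ℂ) * h_sq hs₀ + (c 1 : ℂ) * h_sq (sub_nonneg.mpr hs₁)
  have hv : star v ⬝ᵥ v = 1 := by simpa using h_moment 1
  refine ⟨diagonal fun i => (d i : ℂ), vecMulVec v (star v), ?_, isStarProjection_vecMulVec hv,
    fun h => ?_, fun r => ?_⟩
  · rw [isStrictlyPositive_iff_posDef, posDef_diagonal_iff]
    exact fun i => by exact_mod_cast hd i
  · have h_trace : star v ⬝ᵥ v = 0 := by
      rw [dotProduct_comm, ← trace_vecMulVec, h, trace_zero]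
    exact one_ne_zero (hv.symm.trans h_trace)
  · rw [diagonal_rpow (fun i => (hd i).le), vecMulVec_mul_mul_vecMulVec, h_moment fun i => d i ^ r,
      Complex.coe_smul]
    simp [d_def, twoPointMoment]

lemma exists_norm_means_eq {s t : ℝ} (hs₀ : 0 < s) (hs₁ : s ≤ 1) (ht : 0 < t) (hα : 0 < α)
    (hp : 0 < p) (hq : 0 < q) :
    ∃ A E : Matrix (Fin 2) (Fin 2) ℂ, IsStrictlyPositive A ∧ 0 ≤ E ∧
      ‖quasiSpectralMean α p A E‖ = (twoPointMoment s t p ^ (α - 1) *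
        twoPointMoment s t (2 * (1 - α) * p)) ^ (1 / p) ∧
      ‖renyiMean α q A E‖ = twoPointMoment s t ((1 - α) * q) ^ (1 / q) := by
  obtain ⟨A, E, hA, hE, hE₀, h⟩ := exists_isStarProjection_rpow_compression hs₀.le hs₁ ht
  have h_pos := twoPointMoment_pos hs₀ hs₁ ht
  refine ⟨A, E, hA, hE.nonneg, ?_, ?_⟩
  · rw [norm_quasiSpectralMean hp hA,
      norm_spectralCore_of_isStarProjection hA hE hE₀ h_pos h hα hp]
  · rw [norm_renyiMean hq, norm_renyiCore_of_isStarProjection hA hE hE₀ (fun r => (h_pos r).le) h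
      hα hq]

lemma tendsto_log_div_log_of_le_of_le {f : ℝ → ℝ} {c C r : ℝ} (hc : 0 < c)
    (h : ∀ᶠ t in 𝓝[>] 0, c * t ^ r ≤ f t ∧ f t ≤ C * t ^ r) :
    Tendsto (fun t => Real.log (f t) / Real.log t) (𝓝[>] 0) (𝓝 r) := by
  have h_const (b : ℝ) : Tendsto (fun t => Real.log b / Real.log t + r) (𝓝[>] 0) (𝓝 r) := by
    simpa using (Real.tendsto_log_nhdsGT_zero.const_div_atBot (Real.log b)).add_const r
  have h_log {b t : ℝ} (hb : 0 < b) (ht : t ∈ Set.Ioo 0 1) :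
      Real.log (b * t ^ r) / Real.log t = Real.log b / Real.log t + r := by
    rw [Real.log_mul hb.ne' (Real.rpow_pos_of_pos ht.1 r).ne', Real.log_rpow ht.1, add_div,
      mul_div_cancel_right₀ r (Real.log_neg ht.1 ht.2).ne]
  refine tendsto_of_tendsto_of_tendsto_of_le_of_le' (h_const C) (h_const c) ?_ ?_ <;>
    filter_upwards [h, Ioo_mem_nhdsGT one_pos] with t ⟨h_ge, h_le⟩ ht
  all_goals
    have ht_pow : 0 < t ^ r := Real.rpow_pos_of_pos ht.1 r
    have h_pos : 0 < f t := (by positivity : 0 < c * t ^ r).trans_le h_ge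
    have hC : 0 < C := pos_of_mul_pos_left (h_pos.trans_le h_le) ht_pow.le
  · rw [← h_log hC ht]
    exact div_le_div_of_nonpos_of_le (Real.log_neg ht.1 ht.2).le (Real.log_le_log h_pos h_le)
  · rw [← h_log hc ht]
    exact div_le_div_of_nonpos_of_le (Real.log_neg ht.1 ht.2).le
      (Real.log_le_log (by positivity) h_ge)

lemma tendsto_log_twoPointMoment_div_log {u : ℝ} (hu : 0 < u) (r : ℝ) :
    Tendsto (fun t => Real.log (twoPointMoment (t ^ u) t r) / Real.log t) (𝓝[>] 0)
      (𝓝 (min u r)) := by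
  have h_small : ∀ᶠ t : ℝ in 𝓝[>] 0, t ^ u < 1 / 2 := by
    refine Tendsto.eventually_lt_const (v := 0) (by norm_num)
      (Tendsto.mono_left ?_ nhdsWithin_le_nhds)
    simpa [Real.zero_rpow hu.ne'] using (Real.continuous_rpow_const hu.le).tendsto 0
  refine tendsto_log_div_log_of_le_of_le (c := 1 / 2) (C := 2) (by norm_num) ?_
  filter_upwards [h_small, Ioo_mem_nhdsGT one_pos] with t h_half ht
  have h_min : t ^ min u r = max (t ^ u) (t ^ r) :=
    (Real.antitone_rpow_of_base_le_one ht.1 ht.2.le).map_min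
  have hu_pos := Real.rpow_pos_of_pos ht.1 u
  have hr_pos := Real.rpow_pos_of_pos ht.1 r
  rw [h_min, twoPointMoment]
  constructor
  · rcases max_choice (t ^ u) (t ^ r) with h | h <;> rw [h] <;> nlinarith
  · nlinarith [le_max_left (t ^ u) (t ^ r), le_max_right (t ^ u) (t ^ r)]

lemma le_of_tendsto_log_div_log {f g : ℝ → ℝ} {x y : ℝ}
    (hfg : ∀ᶠ t in 𝓝[>] 0, 0 < f t ∧ f t ≤ g t)
    (hf : Tendsto (fun t => Real.log (f t) / Real.log t) (𝓝[>] 0) (𝓝 x))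
    (hg : Tendsto (fun t => Real.log (g t) / Real.log t) (𝓝[>] 0) (𝓝 y)) : y ≤ x := by
  refine le_of_tendsto_of_tendsto hg hf ?_
  filter_upwards [hfg, Ioo_mem_nhdsGT one_pos] with t ⟨h_pos, h_le⟩ ht
  exact div_le_div_of_nonpos_of_le (Real.log_neg ht.1 ht.2).le (Real.log_le_log h_pos h_le)

lemma tendsto_log_rpow_twoPointMoment_mul_div_log {u : ℝ} (hu : 0 < u) :
    Tendsto (fun t => Real.log ((twoPointMoment (t ^ u) t p ^ (α - 1) *
        twoPointMoment (t ^ u) t (2 * (1 - α) * p)) ^ (1 / p)) / Real.log t) (𝓝[>] 0)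
      (𝓝 (((α - 1) * min u p + min u (2 * (1 - α) * p)) / p)) := by
  have h_lim := (((tendsto_log_twoPointMoment_div_log hu p).const_mul (α - 1)).add
    (tendsto_log_twoPointMoment_div_log hu (2 * (1 - α) * p))).div_const p
  refine h_lim.congr' ?_
  filter_upwards [Ioo_mem_nhdsGT one_pos] with t ht
  have h_pos := twoPointMoment_pos (Real.rpow_pos_of_pos ht.1 u)
    (Real.rpow_le_one ht.1.le ht.2.le hu.le) ht.1
  have h_pow := Real.rpow_pos_of_pos (h_pos p) (α - 1)
  rw [Real.log_rpow (mul_pos h_pow (h_pos _)), Real.log_mul h_pow.ne' (h_pos _).ne',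
    Real.log_rpow (h_pos p)]
  ring

lemma tendsto_log_rpow_twoPointMoment_div_log {u : ℝ} (hu : 0 < u) :
    Tendsto (fun t => Real.log (twoPointMoment (t ^ u) t ((1 - α) * q) ^ (1 / q)) / Real.log t)
      (𝓝[>] 0) (𝓝 (min u ((1 - α) * q) / q)) := by
  refine ((tendsto_log_twoPointMoment_div_log hu ((1 - α) * q)).div_const q).congr' ?_
  filter_upwards [Ioo_mem_nhdsGT one_pos] with t ht
  rw [Real.log_rpow (twoPointMoment_pos (Real.rpow_pos_of_pos ht.1 u)
    (Real.rpow_le_one ht.1.le ht.2.le hu.le) ht.1 _)]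
  ring

lemma norm_le_norm_of_forall_logMajorizedBy [NeZero n]
    {F G : Matrix (Fin n) (Fin n) ℂ → Matrix (Fin n) (Fin n) ℂ}
    (hF : ContinuousOn (fun B => ‖F B‖) {B | 0 ≤ B})
    (hG : ContinuousOn (fun B => ‖G B‖) {B | 0 ≤ B})
    (h : ∀ B : Matrix (Fin n) (Fin n) ℂ, B.PosDef → LogMajorizedBy (F B) (G B)) (hB : 0 ≤ B) :
    ‖F B‖ ≤ ‖G B‖ := by
  rw [← closure_isStrictlyPositive] at hF hG
  exact le_on_closure (fun B hB => (h B (isStrictlyPositive_iff_posDef.mp hB)).norm_le) hF hG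
    (closure_isStrictlyPositive.ge hB)

lemma min_div_le_of_forall_quasiSpectralMean_logMajorizedBy (hα : 0 < α) (hp : 0 < p) (hq : 0 < q)
    (h : ∀ A B : Matrix (Fin 2) (Fin 2) ℂ, A.PosDef → B.PosDef →
      LogMajorizedBy (quasiSpectralMean α p A B) (renyiMean α q A B)) {u : ℝ} (hu : 0 < u) :
    min u ((1 - α) * q) / q ≤ ((α - 1) * min u p + min u (2 * (1 - α) * p)) / p := by
  refine le_of_tendsto_log_div_log ?_ (tendsto_log_rpow_twoPointMoment_mul_div_log hu)
    (tendsto_log_rpow_twoPointMoment_div_log hu)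
  filter_upwards [Ioo_mem_nhdsGT one_pos] with t ht
  have hs := Real.rpow_pos_of_pos ht.1 u
  have hs₁ := Real.rpow_le_one ht.1.le ht.2.le hu.le
  have h_pos := twoPointMoment_pos hs hs₁ ht.1
  obtain ⟨A, E, hA, hE, h_spectral, h_renyi⟩ := exists_norm_means_eq hs hs₁ ht.1 hα hp hq
  rw [← h_spectral, ← h_renyi]
  refine ⟨?_, norm_le_norm_of_forall_logMajorizedBy (continuousOn_norm_quasiSpectralMean hα hp hA)
    (continuousOn_norm_renyiMean hα hq A)
    (fun B hB => h A B (isStrictlyPositive_iff_posDef.mp hA) hB) hE⟩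
  rw [h_spectral]
  exact Real.rpow_pos_of_pos (mul_pos (Real.rpow_pos_of_pos (h_pos p) _) (h_pos _)) _

lemma div_le_min_of_forall_renyiMean_logMajorizedBy (hα : 0 < α) (hp : 0 < p) (hq : 0 < q)
    (h : ∀ A B : Matrix (Fin 2) (Fin 2) ℂ, A.PosDef → B.PosDef →
      LogMajorizedBy (renyiMean α q A B) (quasiSpectralMean α p A B)) {u : ℝ} (hu : 0 < u) :
    ((α - 1) * min u p + min u (2 * (1 - α) * p)) / p ≤ min u ((1 - α) * q) / q := by
  refine le_of_tendsto_log_div_log ?_ (tendsto_log_rpow_twoPointMoment_div_log hu)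
    (tendsto_log_rpow_twoPointMoment_mul_div_log hu)
  filter_upwards [Ioo_mem_nhdsGT one_pos] with t ht
  have hs := Real.rpow_pos_of_pos ht.1 u
  have hs₁ := Real.rpow_le_one ht.1.le ht.2.le hu.le
  obtain ⟨A, E, hA, hE, h_spectral, h_renyi⟩ := exists_norm_means_eq hs hs₁ ht.1 hα hp hq
  rw [← h_spectral, ← h_renyi]
  refine ⟨?_, norm_le_norm_of_forall_logMajorizedBy (continuousOn_norm_renyiMean hα hq A)
    (continuousOn_norm_quasiSpectralMean hα hp hA)
    (fun B hB => h A B (isStrictlyPositive_iff_posDef.mp hA) hB) hE⟩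
  rw [h_renyi]
  exact Real.rpow_pos_of_pos (twoPointMoment_pos hs hs₁ ht.1 _) _

theorem div_le_of_forall_quasiSpectralMean_logMajorizedBy (hα₀ : 0 < α) (hα₁ : α < 1) (hp : 0 < p)
    (hq : 0 < q)
    (h : ∀ A B : Matrix (Fin 2) (Fin 2) ℂ, A.PosDef → B.PosDef →
      LogMajorizedBy (quasiSpectralMean α p A B) (renyiMean α q A B)) : p / q ≤ α := by
  have : 0 < 1 - α := sub_pos.mpr hα₁
  obtain ⟨u, hu, hup, huq, hu2p⟩ :
      ∃ u : ℝ, 0 < u ∧ u ≤ p ∧ u ≤ (1 - α) * q ∧ u ≤ 2 * (1 - α) * p :=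
    ⟨min p (min ((1 - α) * q) (2 * (1 - α) * p)), by positivity, min_le_left _ _,
      (min_le_right _ _).trans (min_le_left _ _), (min_le_right _ _).trans (min_le_right _ _)⟩
  have h_le : u / q ≤ ((α - 1) * u + u) / p := by
    simpa only [min_eq_left hup, min_eq_left huq, min_eq_left hu2p] using
      min_div_le_of_forall_quasiSpectralMean_logMajorizedBy hα₀ hp hq h hu
  rw [div_le_div_iff₀ hq hp] at h_le
  rw [div_le_iff₀ hq]
  refine le_of_mul_le_mul_left ?_ hu
  linarith

theorem le_half_of_forall_renyiMean_logMajorizedBy (hα₀ : 0 < α) (hα₁ : α < 1) (hp : 0 < p)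
    (hq : 0 < q)
    (h : ∀ A B : Matrix (Fin 2) (Fin 2) ℂ, A.PosDef → B.PosDef →
      LogMajorizedBy (renyiMean α q A B) (quasiSpectralMean α p A B)) :
    α ≤ 1 / 2 ∧ 1 / 2 ≤ p / q := by
  have hα' : 0 < 1 - α := sub_pos.mpr hα₁
  set u := 2 * (1 - α) * p with u_def
  have hu : 0 < u := by positivity
  have h_le : ((α - 1) * min u p + u) / p ≤ min u ((1 - α) * q) / q := by
    simpa only [← u_def, min_self] using
      div_le_min_of_forall_renyiMean_logMajorizedBy hα₀ hp hq h hu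
  rw [div_le_div_iff₀ hp hq] at h_le
  constructor
  · have h_spectral : α * u ≤ (α - 1) * min u p + u := by nlinarith [min_le_left u p]
    have h_renyi : min u ((1 - α) * q) ≤ (1 - α) * q := min_le_right _ _
    have h_main : (α * u) * q ≤ (1 - α) * q * p := by
      calc _ ≤ _ := by gcongr
        _ ≤ _ := h_le
        _ ≤ _ := by gcongr
    have : (2 * α) * ((1 - α) * q * p) ≤ 1 * ((1 - α) * q * p) := by
      rw [u_def] at h_main
      linarith
    linarith [le_of_mul_le_mul_right this (by positivity)]
  · have h_spectral : (1 - α) * p ≤ (α - 1) * min u p + u := by nlinarith [min_le_right u p]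
    have h_main : (1 - α) * p * q ≤ u * p := by
      calc _ ≤ _ := by gcongr
        _ ≤ _ := h_le
        _ ≤ _ := by gcongr; exact min_le_left _ _
    rw [le_div_iff₀ hq]
    refine le_of_mul_le_mul_left ?_ (mul_pos hα' hp)
    rw [u_def] at h_main
    linarith

end Necessity

end Matrix

end QuasiMean

end

theorem theorem3p6 (α p q : ℝ) (hα₀ : 0 < α) (hα₁ : α < 1) (hp : 0 < p) (hq : 0 < q) :
    List.TFAE [
      ∀ (n : ℕ) (A B : Matrix (Fin n) (Fin n) ℂ), A.PosSemidef → B.PosSemidef →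
        QuasiMean.supportProj B ≤ QuasiMean.supportProj A →
        QuasiMean.LogMajorizedBy (QuasiMean.quasiSpectralMean α p A B)
          (QuasiMean.renyiMean α q A B),
      ∀ A B : Matrix (Fin 2) (Fin 2) ℂ, A.PosDef → B.PosDef →
        QuasiMean.LogMajorizedBy (QuasiMean.quasiSpectralMean α p A B)
          (QuasiMean.renyiMean α q A B),
      p / q ≤ α] ∧
    (α ≤ 1 / 2 → q ≤ p →
      ∀ (n : ℕ) (A B : Matrix (Fin n) (Fin n) ℂ), A.PosSemidef → B.PosSemidef →
        QuasiMean.supportProj B ≤ QuasiMean.supportProj A →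
        QuasiMean.LogMajorizedBy (QuasiMean.renyiMean α q A B)
          (QuasiMean.quasiSpectralMean α p A B)) ∧
    ((∀ A B : Matrix (Fin 2) (Fin 2) ℂ, A.PosDef → B.PosDef →
        QuasiMean.LogMajorizedBy (QuasiMean.renyiMean α q A B)
          (QuasiMean.quasiSpectralMean α p A B)) →
      α ≤ 1 / 2 ∧ 1 / 2 ≤ p / q) := by
  refine ⟨?_, fun hα hqp n A B hA hB =>
    QuasiMean.renyiMean_logMajorizedBy_quasiSpectralMean hα₀ hα hq hqp hA.nonneg hB.nonneg,
    QuasiMean.le_half_of_forall_renyiMean_logMajorizedBy hα₀ hα₁ hp hq⟩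
  tfae_have 1 → 2 := fun h A B hA hB =>
    h 2 A B hA.posSemidef hB.posSemidef (QuasiMean.supportProj_le_of_isUnit hA.isUnit B)
  tfae_have 2 → 3 :=
    QuasiMean.div_le_of_forall_quasiSpectralMean_logMajorizedBy hα₀ hα₁ hp hq
  tfae_have 3 → 1 := fun hpq n A B hA hB =>
    QuasiMean.quasiSpectralMean_logMajorizedBy_renyiMean hα₀ hα₁ hp hq hpq hA.nonneg hB.nonneg
  tfae_finish
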